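/- Let $S$ be a smooth, integral, projective (equivalently, proper) surface over $\mathbb{C}$ and let $V\subset H^0(S,\Omega^1_S)$ be a linear subspace whose evaluation map $V\otimes\mathcal{O}_S\to\Omega^1_S$ is surjective at the generic point of $S$. Let $\overline{\Omega^1_S}\subset\Omega^1_S$ be the image sheaf of this evaluation map, and let $F_V$ be the base divisor of $V$, i.e. the effective divisor such that the image of $\Lambda^2V\otimes\mathcal{O}_S\to\omega_S$ equals $\omega_S(-F_V)\otimes\mathcal{I}_Z$ with $Z\subset S$ a closed subscheme of codimension at least $2$. Suppose that $F_V$ is reduced, with normal crossings and smooth irreducible components, and that $F_V$ is contracted by $V$, i.e. the composition $$V\otimes\mathcal{O}_S\longrightarrow\Omega^1_S\longrightarrow\Omega^1_S|_{F_V}\longrightarrow\omega_{F_V}$$ vanishes, where $\omega_{F_V}$ is the dualizing sheaf of the curve $F_V$ (equivalently: every form in $V$ restricts to the zero rational differential on every irreducible component of $F_V$). Then there is an isomorphism of $\mathcal{O}_S$-modules $$\overline{\Omega^1_S}^{\,**}\;\cong\;\Omega^1_S(\log F_V)(-F_V),$$ where $M^*=\mathcal{H}om_{\mathcal{O}_S}(M,\mathcal{O}_S)$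 and $\Omega^1_S(\log F_V)$ is the sheaf of rational $1$-forms locally generated by the regular $1$-forms and by the forms $df/f$, for $f$ a local equation of a component of $F_V$. -/

import Mathlib

open CategoryTheory AlgebraicGeometry TopologicalSpace Opposite
open scoped KaehlerDifferential

noncomputable section

namespace ContractedDivisor

/-! ### Duals of sheaves of modules -/

section Dual

variable {X : Scheme.{0}}

/-- A section over `U` of the sheaf `Hom(M, 𝒪_X)`: a morphism `M|_U ⟶ 𝒪_U` of sheaves of
modules, given by compatible linear maps on the opens contained in `U`. -/
@[ext]
structure DualSection (M : X.Modules) (U : X.Opens) where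
  app (W : X.Opens) (hW : W ≤ U) : Γ(M, W) →ₗ[Γ(X, W)] Γ(X, W)
  naturality {W W' : X.Opens} (h : W' ≤ W) (hW : W ≤ U) (m : Γ(M, W)) :
    app W' (h.trans hW) (M.presheaf.map (homOfLE h).op m) =
      X.presheaf.map (homOfLE h).op (app W hW m)

namespace DualSection

variable {M : X.Modules} {U : X.Opens}

instance : Zero (DualSection M U) := ⟨⟨fun _ _ => 0, by simp⟩⟩

instance : Add (DualSection M U) :=
  ⟨fun φ ψ => ⟨fun W hW => φ.app W hW + ψ.app W hW, fun h hW m => by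
    simp [φ.naturality h hW m, ψ.naturality h hW m]⟩⟩

instance : Neg (DualSection M U) :=
  ⟨fun φ => ⟨fun W hW => -φ.app W hW, fun h hW m => by simp [φ.naturality h hW m]⟩⟩

instance : Sub (DualSection M U) :=
  ⟨fun φ ψ => ⟨fun W hW => φ.app W hW - ψ.app W hW, fun h hW m => by
    simp [φ.naturality h hW m, ψ.naturality h hW m]⟩⟩

@[simp] lemma zero_app (W : X.Opens) (hW : W ≤ U) : (0 : DualSection M U).app W hW = 0 := rfl

@[simp] lemma add_app (φ ψ : DualSection M U) (W : X.Opens) (hW : W ≤ U) :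
    (φ + ψ).app W hW = φ.app W hW + ψ.app W hW := rfl

@[simp] lemma neg_app (φ : DualSection M U) (W : X.Opens) (hW : W ≤ U) :
    (-φ).app W hW = -φ.app W hW := rfl

@[simp] lemma sub_app (φ ψ : DualSection M U) (W : X.Opens) (hW : W ≤ U) :
    (φ - ψ).app W hW = φ.app W hW - ψ.app W hW := rfl

instance : AddCommGroup (DualSection M U) where
  add_assoc a b c := by ext; simp [add_assoc]
  zero_add a := by ext; simp
  add_zero a := by ext; simp
  add_comm a b := by ext; simp [add_comm]
  neg_add_cancel a := by ext; simp
  sub_eq_add_neg a b := by ext; simp [sub_eq_add_neg]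
  nsmul := nsmulRec
  zsmul := zsmulRec

/-- `𝒪_X(U)` acts on the values, after restriction. -/
instance : SMul Γ(X, U) (DualSection M U) :=
  ⟨fun r φ => ⟨fun W hW => X.presheaf.map (homOfLE hW).op r • φ.app W hW, fun h hW m => by
    simp only [LinearMap.smul_apply, smul_eq_mul, map_mul, φ.naturality h hW m]
    rw [← ConcreteCategory.comp_apply, ← X.presheaf.map_comp]
    rfl⟩⟩

@[simp] lemma smul_app (r : Γ(X, U)) (φ : DualSection M U) (W : X.Opens) (hW : W ≤ U) :
    (r • φ).app W hW = X.presheaf.map (homOfLE hW).op r • φ.app W hW := rfl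

instance : Module Γ(X, U) (DualSection M U) where
  one_smul a := by ext; simp
  mul_smul a b c := by ext; simp [mul_assoc]
  smul_zero a := by ext; simp
  smul_add a b c := by ext; simp
  add_smul a b c := by ext; simp [add_mul]
  zero_smul a := by ext; simp

/-- Restriction of sections of the dual to a smaller open. -/
def res {U' : X.Opens} (h : U' ≤ U) : DualSection M U →+ DualSection M U' where
  toFun φ := ⟨fun W hW => φ.app W (hW.trans h), fun h' hW m => φ.naturality h' (hW.trans h) m⟩
  map_zero' := rfl
  map_add' _ _ := rfl

@[simp] lemma res_app {U' : X.Opens} (h : U' ≤ U) (φ : DualSection M U) (W : X.Opens)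
    (hW : W ≤ U') : (res h φ).app W hW = φ.app W (hW.trans h) := rfl

end DualSection

theorem DualSection.res_smul {M : X.Modules} {U U' : X.Opens} (h : U' ≤ U) (r : Γ(X, U))
    (φ : DualSection M U) :
    DualSection.res h (r • φ) = X.presheaf.map (homOfLE h).op r • DualSection.res h φ := by
  refine DualSection.ext ?_
  funext W hW
  ext m
  simp only [DualSection.res_app, DualSection.smul_app, LinearMap.smul_apply]
  rw [← ConcreteCategory.comp_apply, ← X.presheaf.map_comp]
  rfl

/-- The presheaf of abelian groups underlying the dual. -/
def dualPresheaf (M : X.Modules) : TopCat.Presheaf Ab X where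
  obj U := AddCommGrpCat.of (DualSection M U.unop)
  map i := AddCommGrpCat.ofHom (DualSection.res i.unop.le)
  map_id _ := rfl
  map_comp _ _ := rfl


theorem dualPresheaf_isSheaf (M : X.Modules) : (dualPresheaf M).IsSheaf := by
  rw [TopCat.Presheaf.isSheaf_iff_isSheafUniqueGluing]
  intro ι U sf hsf
  have hcomp : ∀ (i j : ι) (W : X.Opens) (hi : W ≤ U i) (hj : W ≤ U j),
      (sf i).app W hi = (sf j).app W hj := by
    intro i j W hi hj
    have := hsf i j
    exact congr_arg (fun φ : DualSection M (U i ⊓ U j) => φ.app W (le_inf hi hj)) this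
  have hres : ∀ {W₁ W₂ W₃ : X.Opens} (h₁ : W₂ ≤ W₁) (h₂ : W₃ ≤ W₂) (m : Γ(M, W₁)),
      M.presheaf.map (homOfLE h₂).op (M.presheaf.map (homOfLE h₁).op m) =
        M.presheaf.map (homOfLE (h₂.trans h₁)).op m := by
    intro W₁ W₂ W₃ h₁ h₂ m
    rw [← ConcreteCategory.comp_apply, ← M.presheaf.map_comp]
    rfl
  have hresX : ∀ {W₁ W₂ W₃ : X.Opens} (h₁ : W₂ ≤ W₁) (h₂ : W₃ ≤ W₂) (m : Γ(X, W₁)),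
      X.presheaf.map (homOfLE h₂).op (X.presheaf.map (homOfLE h₁).op m) =
        X.presheaf.map (homOfLE (h₂.trans h₁)).op m := by
    intro W₁ W₂ W₃ h₁ h₂ m
    rw [← ConcreteCategory.comp_apply, ← X.presheaf.map_comp]
    rfl
  have hcov : ∀ W : X.Opens, W ≤ iSup U → W ≤ ⨆ i, W ⊓ U i := by
    intro W hW
    rw [← inf_iSup_eq]
    exact le_inf le_rfl hW
  have hglue : ∀ (W : X.Opens) (_ : W ≤ iSup U) (m : Γ(M, W)), ∃ f : Γ(X, W), ∀ i,
      X.presheaf.map (homOfLE (inf_le_left : W ⊓ U i ≤ W)).op f =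
        (sf i).app (W ⊓ U i) inf_le_right (M.presheaf.map (homOfLE inf_le_left).op m) := by
    intro W hW m
    obtain ⟨f, hf, -⟩ := X.sheaf.existsUnique_gluing' (fun i => W ⊓ U i) W
      (fun i => homOfLE inf_le_left) (hcov W hW)
      (fun i => (sf i).app (W ⊓ U i) inf_le_right (M.presheaf.map (homOfLE inf_le_left).op m)) (by
        intro i j
        have e₁ := (sf i).naturality (W := W ⊓ U i) (W' := (W ⊓ U i) ⊓ (W ⊓ U j)) inf_le_left
          inf_le_right (M.presheaf.map (homOfLE inf_le_left).op m)
        have e₂ := (sf j).naturality (W := W ⊓ U j) (W' := (W ⊓ U i) ⊓ (W ⊓ U j)) inf_le_right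
          inf_le_right (M.presheaf.map (homOfLE inf_le_left).op m)
        rw [hres] at e₁ e₂
        refine e₁.symm.trans (Eq.trans ?_ e₂)
        rw [hcomp i j])
    exact ⟨f, hf⟩
  have hsep : ∀ (W : X.Opens) (_ : W ≤ iSup U) (f g : Γ(X, W)),
      (∀ i, X.presheaf.map (homOfLE (inf_le_left : W ⊓ U i ≤ W)).op f =
        X.presheaf.map (homOfLE (inf_le_left : W ⊓ U i ≤ W)).op g) → f = g := by
    intro W hW f g h
    exact X.sheaf.eq_of_locally_eq' (fun i => W ⊓ U i) W
      (fun i => homOfLE inf_le_left) (hcov W hW) f g h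
  choose f hf using hglue
  let s : DualSection M (iSup U) :=
    { app := fun W hW =>
        { toFun := fun m => f W hW m
          map_add' := fun m m' => hsep W hW _ _ fun i => by simp [hf]
          map_smul' := fun r m => hsep W hW _ _ fun i => by simp [hf] }
      naturality := by
        intro W W' h hW m
        refine hsep W' (h.trans hW) _ _ fun i => ?_
        have h₁ := hf W' (h.trans hW) (M.presheaf.map (homOfLE h).op m) i
        have h₂ := congr_arg (X.presheaf.map (homOfLE (inf_le_inf_right (U i) h)).op) (hf W hW m i)
        rw [← (sf i).naturality (inf_le_inf_right (U i) h) inf_le_right, hres, hresX] at h₂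
        rw [hres] at h₁
        refine h₁.trans (h₂.symm.trans ?_)
        exact (hresX h inf_le_left _).symm }
  refine ⟨s, ?_, ?_⟩
  · intro i
    refine DualSection.ext ?_
    funext W hW
    ext m
    refine hsep W (hW.trans (le_iSup U i)) _ _ fun j => ?_
    refine (hf W _ m j).trans ?_
    rw [← hcomp i j _ (inf_le_left.trans hW)]
    exact (sf i).naturality inf_le_left hW m
  · intro t ht
    refine DualSection.ext ?_
    funext W hW
    ext m
    refine hsep W hW _ _ fun j => ?_
    refine Eq.trans ?_ (hf W hW m j).symm
    rw [← t.naturality inf_le_left hW m]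
    exact congr_arg (fun φ : DualSection M (U j) => φ.app (W ⊓ U j) inf_le_right
      (M.presheaf.map (homOfLE inf_le_left).op m)) (ht j)

instance (M : X.Modules) (U : (Opens X)ᵒᵖ) :
    Module (X.ringCatSheaf.obj.obj U) ((dualPresheaf M).obj U) :=
  inferInstanceAs (Module Γ(X, U.unop) (DualSection M U.unop))

/-- The dual `M^* = Hom(M, 𝒪_X)` of a sheaf of modules. -/
def dual (M : X.Modules) : X.Modules where
  val := PresheafOfModules.ofPresheaf (R := X.ringCatSheaf.obj) (dualPresheaf M)
    (fun _ _ i r φ => DualSection.res_smul (M := M) i.unop.le r φ)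
  isSheaf := dualPresheaf_isSheaf M

end Dual

/-! ### Differential forms -/

section Forms

variable (S : Scheme.{0}) [S.Over (Spec (.of ℂ))]

/-- The map `ℂ ⟶ Γ(S, U)` given by the structure morphism. -/
def constants (U : S.Opens) : ℂ →+* Γ(S, U) :=
  (S.presheaf.map (homOfLE le_top).op).hom.comp
    ((Scheme.ΓSpecIso (.of ℂ)).inv ≫ (S ↘ Spec (.of ℂ)).appTop).hom

instance stalkAlgebra (x : S) : Algebra ℂ (S.presheaf.stalk x) :=
  ((S.presheaf.germ ⊤ x trivial).hom.comp
    ((Scheme.ΓSpecIso (.of ℂ)).inv ≫ (S ↘ Spec (.of ℂ)).appTop).hom).toAlgebra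

lemma germ_constants {U : S.Opens} (x : S) (hx : x ∈ U) (c : ℂ) :
    S.presheaf.germ U x hx (constants S U c) = algebraMap ℂ (S.presheaf.stalk x) c :=
  S.presheaf.germ_res_apply _ _ _ _

/-- The stalk at `x` of the sheaf of differentials `Ω¹_S` over `ℂ`. -/
abbrev FormStalk (x : S) : Type := Ω[S.presheaf.stalk x⁄ℂ]

variable {S}

/-- A family of germs of `1`-forms is a section of `Ω¹_S` when it is locally of the form
`∑ aᵢ dbᵢ` with regular functions `aᵢ`, `bᵢ`. -/
def IsForm {U : S.Opens} (s : ∀ x : U, FormStalk S x.1) : Prop :=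
  ∀ x ∈ U, ∃ (W : S.Opens) (hW : W ≤ U), x ∈ W ∧ ∃ (n : ℕ) (a b : Fin n → Γ(S, W)),
    ∀ (y : S) (hy : y ∈ W), s ⟨y, hW hy⟩ = ∑ i, S.presheaf.germ W y hy (a i) •
      KaehlerDifferential.D ℂ (S.presheaf.stalk y) (S.presheaf.germ W y hy (b i))

/-- The sections over `U` of the subsheaf of `Ω¹_S` of forms whose germ at each `x` lies in
`N x`. -/
def formSections (N : ∀ x : S, Submodule (S.presheaf.stalk x) (FormStalk S x)) (U : S.Opens) :
    Submodule ℂ (∀ x : U, FormStalk S x.1) where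
  carrier := {s | IsForm s ∧ ∀ x : U, s x ∈ N x.1}
  zero_mem' := ⟨fun x hx => ⟨U, le_rfl, hx, 0, 0, 0, by simp⟩, fun x => (N x.1).zero_mem⟩
  add_mem' := by
    rintro s t ⟨hs, hs'⟩ ⟨ht, ht'⟩
    refine ⟨fun x hx => ?_, fun x => (N x.1).add_mem (hs' x) (ht' x)⟩
    obtain ⟨W, hW, hxW, n, a, b, h⟩ := hs x hx
    obtain ⟨W', hW', hxW', n', a', b', h'⟩ := ht x hx
    refine ⟨W ⊓ W', inf_le_left.trans hW, ⟨hxW, hxW'⟩, n + n',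
      Fin.append (fun i => S.presheaf.map (homOfLE inf_le_left).op (a i))
        (fun i => S.presheaf.map (homOfLE inf_le_right).op (a' i)),
      Fin.append (fun i => S.presheaf.map (homOfLE inf_le_left).op (b i))
        (fun i => S.presheaf.map (homOfLE inf_le_right).op (b' i)), fun y hy => ?_⟩
    rw [Fin.sum_univ_add]
    simp only [Fin.append_left, Fin.append_right]
    refine congr_arg₂ (· + ·) ((h y hy.1).trans ?_) ((h' y hy.2).trans ?_) <;>
    · refine Finset.sum_congr rfl fun i _ => ?_
      rw [TopCat.Presheaf.germ_res_apply, TopCat.Presheaf.germ_res_apply]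
  smul_mem' := by
    rintro c s ⟨hs, hs'⟩
    refine ⟨fun x hx => ?_, fun x => (N x.1).smul_of_tower_mem c (hs' x)⟩
    obtain ⟨W, hW, hxW, n, a, b, h⟩ := hs x hx
    refine ⟨W, hW, hxW, n, fun i => constants S W c * a i, b, fun y hy => ?_⟩
    refine (congr_arg (c • ·) (h y hy)).trans ?_
    simp only [Finset.smul_sum, map_mul, germ_constants, mul_smul, algebraMap_smul]

variable (N : ∀ x : S, Submodule (S.presheaf.stalk x) (FormStalk S x))

/-- Regular functions act on forms germ by germ. -/
instance (U : S.Opens) : SMul Γ(S, U) (formSections N U) where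
  smul r s := ⟨fun x => S.presheaf.germ U x.1 x.2 r • s.1 x, fun x hx => by
    obtain ⟨W, hW, hxW, n, a, b, h⟩ := s.2.1 x hx
    refine ⟨W, hW, hxW, n, fun i => S.presheaf.map (homOfLE hW).op r * a i, b, fun y hy => ?_⟩
    refine (congr_arg (S.presheaf.germ U y (hW hy) r • ·) (h y hy)).trans ?_
    simp only [Finset.smul_sum, map_mul, mul_smul, TopCat.Presheaf.germ_res_apply],
    fun x => (N x.1).smul_mem _ (s.2.2 x)⟩

lemma coe_smul_formSections (U : S.Opens) (r : Γ(S, U)) (s : formSections N U) (x : U) :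
    (r • s).1 x = S.presheaf.germ U x.1 x.2 r • s.1 x := rfl

instance (U : S.Opens) : Module Γ(S, U) (formSections N U) where
  one_smul s := Subtype.ext <| funext fun x => by simp [coe_smul_formSections]
  mul_smul r r' s := Subtype.ext <| funext fun x => by simp [coe_smul_formSections, mul_smul]
  smul_zero r := Subtype.ext <| funext fun x => by simp [coe_smul_formSections]
  smul_add r s t := Subtype.ext <| funext fun x => by simp [coe_smul_formSections]
  add_smul r r' s := Subtype.ext <| funext fun x => by simp [coe_smul_formSections, add_smul]
  zero_smul s := Subtype.ext <| funext fun x => by simp [coe_smul_formSections]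

/-- Restriction of forms to a smaller open. -/
def formRes {U U' : S.Opens} (h : U' ≤ U) : formSections N U →+ formSections N U' where
  toFun s := ⟨fun x => s.1 ⟨x.1, h x.2⟩, fun x hx => by
    obtain ⟨W, hW, hxW, n, a, b, e⟩ := s.2.1 x (h hx)
    refine ⟨W ⊓ U', inf_le_right, ⟨hxW, hx⟩, n,
      fun i => S.presheaf.map (homOfLE inf_le_left).op (a i),
      fun i => S.presheaf.map (homOfLE inf_le_left).op (b i), fun y hy => ?_⟩
    refine (e y hy.1).trans (Finset.sum_congr rfl fun i _ => ?_)
    rw [TopCat.Presheaf.germ_res_apply, TopCat.Presheaf.germ_res_apply], fun x => s.2.2 ⟨x.1, h x.2⟩⟩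
  map_zero' := rfl
  map_add' _ _ := rfl

lemma formRes_smul {U U' : S.Opens} (h : U' ≤ U) (r : Γ(S, U)) (s : formSections N U) :
    formRes N h (r • s) = S.presheaf.map (homOfLE h).op r • formRes N h s := by
  refine Subtype.ext <| funext fun x => ?_
  refine Eq.trans ?_ (coe_smul_formSections N U' _ _ x).symm
  rw [TopCat.Presheaf.germ_res_apply]
  rfl

/-- The presheaf of abelian groups underlying a subsheaf of `Ω¹_S`. -/
def formPresheaf : TopCat.Presheaf Ab S where
  obj U := AddCommGrpCat.of (formSections N U.unop)
  map i := AddCommGrpCat.ofHom (formRes N i.unop.le)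
  map_id _ := rfl
  map_comp _ _ := rfl

lemma coe_formRes {U U' : S.Opens} (h : U' ≤ U) (s : formSections N U) (x : U') :
    (formRes N h s).1 x = s.1 ⟨x.1, h x.2⟩ := rfl

theorem formPresheaf_isSheaf : (formPresheaf N).IsSheaf := by
  rw [TopCat.Presheaf.isSheaf_iff_isSheafUniqueGluing]
  intro ι U (sf : ∀ i, formSections N (U i)) hsf
  have hsf' : ∀ i j, formRes N (inf_le_left : U i ⊓ U j ≤ U i) (sf i) =
    formRes N inf_le_right (sf j) := hsf
  have hcomp : ∀ (i j : ι) (x : S) (hi : x ∈ U i) (hj : x ∈ U j),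
      (sf i).1 ⟨x, hi⟩ = (sf j).1 ⟨x, hj⟩ := by
    intro i j x hi hj
    have h := congr_arg (fun s => s.1 ⟨x, ⟨hi, hj⟩⟩) (hsf' i j)
    simpa only [coe_formRes] using h
  have hmem : ∀ x : (iSup U : S.Opens), ∃ i, x.1 ∈ U i := fun x => Opens.mem_iSup.1 x.2
  choose k hk using hmem
  have hs : (fun x : (iSup U : S.Opens) => (sf (k x)).1 ⟨x.1, hk x⟩) ∈
      formSections N (iSup U) := by
    refine ⟨fun x hx => ?_, fun x => (sf (k x)).2.2 ⟨x.1, hk x⟩⟩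
    obtain ⟨i, hi⟩ := Opens.mem_iSup.1 hx
    obtain ⟨W, hW, hxW, n, a, b, e⟩ := (sf i).2.1 x hi
    refine ⟨W, hW.trans (le_iSup U i), hxW, n, a, b, fun y hy => Eq.trans ?_ (e y hy)⟩
    exact hcomp _ i y _ (hW hy)
  have hgl : ∃! s : formSections N (iSup U), ∀ i, formRes N (le_iSup U i) s = sf i := by
    refine ⟨⟨_, hs⟩, fun i => Subtype.ext (funext fun x => ?_), fun t ht =>
      Subtype.ext (funext fun x => ?_)⟩
    · rw [coe_formRes]
      exact hcomp _ i x.1 _ x.2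
    · have h := congr_arg (fun s => s.1 ⟨x.1, hk x⟩) (ht (k x))
      simpa only [coe_formRes] using h
  exact hgl

instance (U : (Opens S)ᵒᵖ) : Module (S.ringCatSheaf.obj.obj U) ((formPresheaf N).obj U) :=
  inferInstanceAs (Module Γ(S, U.unop) (formSections N U.unop))

/-- The subsheaf of modules of `Ω¹_S` of forms whose germ at each `x` lies in `N x`. -/
def formSheaf : S.Modules where
  val := PresheafOfModules.ofPresheaf (R := S.ringCatSheaf.obj) (formPresheaf N)
    (fun _ _ i r s => formRes_smul N i.unop.le r s)
  isSheaf := formPresheaf_isSheaf N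

variable (S) in
/-- The sheaf of differentials `Ω¹_S`. -/
def omega : S.Modules := formSheaf (S := S) fun _ => ⊤

variable (S) in
/-- The space `H⁰(S, Ω¹_S)` of global `1`-forms. -/
abbrev GlobalForms : Type := formSections (S := S) (fun _ => ⊤) ⊤

/-- The germ at `x` of a global form. -/
def GlobalForms.germ (x : S) (ω : GlobalForms S) : FormStalk S x := ω.1 ⟨x, trivial⟩

/-- The stalk at `x` of the image of the evaluation map `V ⊗ 𝒪_S ⟶ Ω¹_S`. -/
def evalStalk (V : Submodule ℂ (GlobalForms S)) (x : S) :
    Submodule (S.presheaf.stalk x) (FormStalk S x) :=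
  Submodule.span _ (GlobalForms.germ x '' V)

/-- The image of the evaluation map `V ⊗ 𝒪_S ⟶ Ω¹_S`. -/
def omegaBar (V : Submodule ℂ (GlobalForms S)) : S.Modules := formSheaf (evalStalk V)

end Forms

/-! ### Divisors -/

section Divisors

variable (S : Scheme.{0})

/-- A prime divisor, given by its generic point: a point whose local ring has dimension one. -/
structure PrimeDivisor where
  point : S
  dim_eq_one : ringKrullDim (S.presheaf.stalk point) = 1

/-- An effective (Weil) divisor. -/
abbrev EffectiveDivisor := PrimeDivisor S →₀ ℕ

variable {S}

/-- The ideal of the prime divisor `C` in the local ring at a point `x` of `C`. -/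
def PrimeDivisor.idealAt (C : PrimeDivisor S) {x : S} (h : C.point ⤳ x) :
    Ideal (S.presheaf.stalk x) :=
  (IsLocalRing.maximalIdeal (S.presheaf.stalk C.point)).comap
    (S.presheaf.stalkSpecializes h).hom

namespace EffectiveDivisor

/-- The stalk at `x` of `𝒪_S(-D)`: the functions vanishing along each prime divisor through `x`
to at least the order prescribed by `D`. -/
def idealAt (D : EffectiveDivisor S) (x : S) : Ideal (S.presheaf.stalk x) :=
  ⨅ (C : PrimeDivisor S) (h : C.point ⤳ x),
    (IsLocalRing.maximalIdeal (S.presheaf.stalk C.point) ^ D C).comap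
      (S.presheaf.stalkSpecializes h).hom

/-- `D` is reduced. -/
def IsReduced (D : EffectiveDivisor S) : Prop := ∀ C, D C ≤ 1

/-- `D` has normal crossings and smooth irreducible components: at every point of `S` the maximal
ideal of the (Zariski) local ring has generators `t₁, …, tₙ`, `n` being the dimension of the local
ring, such that `D` is defined there by the product of some of the `tᵢ` (the empty product, away
from `D`). -/
def HasSimpleNormalCrossings (D : EffectiveDivisor S) : Prop :=
  ∀ x : S, ∃ (n : ℕ) (t : Fin n → S.presheaf.stalk x) (T : Finset (Fin n)),
    ringKrullDim (S.presheaf.stalk x) = n ∧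
    Ideal.span (Set.range t) = IsLocalRing.maximalIdeal (S.presheaf.stalk x) ∧
    D.idealAt x = Ideal.span {∏ i ∈ T, t i}

end EffectiveDivisor

variable [S.Over (Spec (.of ℂ))]

/-- The stalk at `x` of the image of `Λ²V ⊗ 𝒪_S ⟶ ω_S = Λ²Ω¹_S`. -/
def wedgeStalk (V : Submodule ℂ (GlobalForms S)) (x : S) :
    Submodule (S.presheaf.stalk x) (⋀[S.presheaf.stalk x]^2 (FormStalk S x)) :=
  Submodule.span _ {η | ∃ v ∈ V, ∃ w ∈ V,
    η = exteriorPower.ιMulti (S.presheaf.stalk x) 2 ![GlobalForms.germ x v, GlobalForms.germ x w]}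

/-- `F` is the base divisor of the linear system given by `Λ²V ⟶ H⁰(S, ω_S)`: the image of
`Λ²V ⊗ 𝒪_S ⟶ ω_S` agrees with `ω_S(-F)` at the generic point of every prime divisor, that is, it
is `I_Z ⊗ ω_S(-F)` for a subscheme `Z` of codimension at least two. -/
def IsBaseDivisor (V : Submodule ℂ (GlobalForms S)) (F : EffectiveDivisor S) : Prop :=
  ∀ C : PrimeDivisor S, wedgeStalk V C.point =
    IsLocalRing.maximalIdeal (S.presheaf.stalk C.point) ^ F C •
      (⊤ : Submodule (S.presheaf.stalk C.point)
        (⋀[S.presheaf.stalk C.point]^2 (FormStalk S C.point)))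

/-- The divisor `D`, supposed to be reduced, is contracted by `V`: the composition
`V ⊗ 𝒪_S ⟶ Ω¹_S ⟶ Ω¹_S|_D ⟶ ω_D` vanishes. As `ω_D` is the sheaf of regular differentials, a
subsheaf of the sheaf of rational differentials of `D`, this means that for every `ω ∈ V` and
every component `C` of `D` the restriction of `ω` to `C` vanishes as a rational differential
of `C`, that is, in the differentials over `ℂ` of the function field of `C`. -/
def IsContractedBy (D : EffectiveDivisor S) (V : Submodule ℂ (GlobalForms S)) : Prop :=
  ∀ C : PrimeDivisor S, D C ≠ 0 → ∀ ω ∈ V,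
    KaehlerDifferential.map ℂ ℂ (S.presheaf.stalk C.point)
      (IsLocalRing.ResidueField (S.presheaf.stalk C.point)) (GlobalForms.germ C.point ω) = 0

/-! ### Logarithmic forms -/

variable [IsIntegral S]

instance (x : S) : IsScalarTower ℂ (S.presheaf.stalk x) S.functionField := by
  refine IsScalarTower.of_algebraMap_eq fun c => ?_
  exact (S.presheaf.germ_stalkSpecializes_apply _ _ _).symm

/-- The map from germs at `x` of regular forms to rational forms. -/
def toRational (x : S) :
    FormStalk S x →ₗ[S.presheaf.stalk x] Ω[S.functionField⁄ℂ] :=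
  KaehlerDifferential.map ℂ ℂ (S.presheaf.stalk x) S.functionField

/-- The stalk at `x` of `Ω¹_S(log D)`, as a module of rational forms: it is generated by the
regular forms and by the forms `df / f`, with `f` a local equation at `x` of a component of `D`. -/
def logStalk (D : EffectiveDivisor S) (x : S) :
    Submodule (S.presheaf.stalk x) Ω[S.functionField⁄ℂ] :=
  LinearMap.range (toRational x) ⊔
    Submodule.span _ {η | ∃ (C : PrimeDivisor S) (h : C.point ⤳ x) (f : S.presheaf.stalk x),
      D C ≠ 0 ∧ C.idealAt h = Ideal.span {f} ∧
      η = (algebraMap (S.presheaf.stalk x) S.functionField f)⁻¹ •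
        KaehlerDifferential.D ℂ S.functionField (algebraMap (S.presheaf.stalk x) S.functionField f)}

/-- The sheaf `Ω¹_S(log D)(-D) = 𝒪_S(-D) · Ω¹_S(log D)`. It consists of regular forms, since
`f · df / f = df`, and is therefore defined as a subsheaf of `Ω¹_S`. -/
def omegaLogTwist (D : EffectiveDivisor S) : S.Modules :=
  formSheaf fun x => (D.idealAt x • logStalk D x).comap (toRational x)

end Divisors

end ContractedDivisor

end

open ContractedDivisor

open CategoryTheory AlgebraicGeometry TopologicalSpace Opposite
open scoped KaehlerDifferential TensorProduct

noncomputable section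

/-! Both sheaves are reflexive on a regular surface, so it suffices that they agree at the generic
point of every prime divisor $C$. Let $R$ be the local ring there, $t$ a uniformizer. If $C$ is not
in $F$, the determinants of pairs in $V$ generate the unit ideal, so $V$ generates $\Omega^1$. If
$C$ is in $F$, contraction and the conormal sequence put $V$ inside $t\Omega^1+R\,dt$
(`mem_of_map_residue_eq_zero`), which is the stalk of $\Omega^1(\log F)(-F)$
(`logTwistStalk_point`). All determinants of pairs from this module lie in $(t)$, and since $F$ is
the base divisor with multiplicity one, those from $V$ already generate $(t)$. Some pair from $V$
then has determinant a unit times $t$, and Cramer's rule shows that it generates the whole module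
(`exists_le_span_pair_of_det`).

The passage from codimension one to the surface is made inside the rational forms $\Omega_K$, $K$
being the function field. Since $V$ spans $\Omega_K$, a section of the dual of the evaluation image
over a nonempty $W$ is a $K$-linear functional $l$ on $\Omega_K$ with $l(v)$ regular on $W$ for all
$v\in V$. A section of the bidual over a nonempty $U$ is a rational form $\omega$ such that
$l(\omega)$ is regular for every such $l$ on every open $W\le U$.

If $\omega$ is a section of the logarithmic sheaf, $l(\omega)$ is regular in codimension one, hence
everywhere by Hartogs (`exists_algebraMap_eq_of_height_one`). Conversely, near the generic point of
$C$ the dual basis of a generating pair from $V$ is a pair of admissible functionals, so a bidual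
section lies in the span of $V$ there (`exists_mem_evalStalk_of_forall`). A form that is logarithmic
in codimension one is logarithmic everywhere: where $t_0,t_1$ are parameters adapted to $F$, the
forms $dt_0,dt_1$ are a basis and the condition can be read on coefficients
(`mem_logTwistStalk_of_forall`). -/

namespace ContractedDivisor

/-! ### Commutative algebra of local rings -/

section LocalAlgebra

open IsLocalRing

variable {R : Type*} [CommRing R] [IsLocalRing R]

/-- A system of `dim R` generators of the maximal ideal is minimal. -/
theorem mem_maximalIdeal_of_sum_mem_sq [IsNoetherianRing R] {n : ℕ} {t : Fin n → R}
    (ht : Ideal.span (Set.range t) = maximalIdeal R) (hn : ringKrullDim R = n)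
    {c : Fin n → R} (hc : ∑ i, c i * t i ∈ maximalIdeal R ^ 2) (j : Fin n) :
    c j ∈ maximalIdeal R := by
  by_contra hj
  have hu : IsUnit (c j) := by simpa using hj
  obtain ⟨u, hu⟩ := hu
  set J : Ideal R := Ideal.span (t '' {j}ᶜ) with hJ
  have hJi : ∀ i, i ≠ j → t i ∈ J := fun i hi => Ideal.subset_span ⟨i, hi, rfl⟩
  have hJm : J ≤ maximalIdeal R := by
    rw [← ht]
    exact Ideal.span_mono (Set.image_subset_range _ _)
  have htj : t j ∈ J ⊔ maximalIdeal R • maximalIdeal R := by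
    rw [smul_eq_mul, ← pow_two]
    have h1 : c j * t j ∈ J ⊔ maximalIdeal R ^ 2 := by
      rw [← Finset.add_sum_erase _ _ (Finset.mem_univ j)] at hc
      refine (Submodule.add_mem_iff_left _ ?_).1 (Submodule.mem_sup_right hc)
      refine Submodule.sum_mem _ fun i hi => Submodule.mem_sup_left ?_
      exact Ideal.mul_mem_left _ _ (hJi i (Finset.ne_of_mem_erase hi))
    have h2 := Ideal.mul_mem_left _ (↑u⁻¹ : R) h1
    rwa [← hu, ← mul_assoc, Units.inv_mul, one_mul] at h2
  have hle : maximalIdeal R ≤ J ⊔ maximalIdeal R • maximalIdeal R := by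
    conv_lhs => rw [← ht]
    rw [Ideal.span_le]
    rintro _ ⟨i, rfl⟩
    by_cases hij : i = j
    · exact hij ▸ htj
    · exact Submodule.mem_sup_left (hJi i hij)
  -- Nakayama turns $m = J + m^2$ into $m = J$, so $m$ would have $n-1$ generators, fewer than the
  -- dimension.
  have hmJ : maximalIdeal R ≤ J :=
    Submodule.le_of_le_smul_of_le_jacobson_bot (IsNoetherian.noetherian _)
      (maximalIdeal_le_jacobson _) hle
  have h := ringKrullDim_le_spanFinrank_maximalIdeal R
  rw [le_antisymm hmJ hJm, hn] at h
  have h2 : J.spanFinrank ≤ (t '' {j}ᶜ).ncard :=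
    Submodule.spanFinrank_span_le_ncard_of_finite (Set.toFinite _)
  have h3 : (t '' {j}ᶜ).ncard ≤ ({j}ᶜ : Set (Fin n)).ncard :=
    Set.ncard_image_le (Set.toFinite _)
  have h4 : ({j}ᶜ : Set (Fin n)).ncard = n - 1 := by
    rw [Set.ncard_compl]; simp
  have h5 : n ≤ J.spanFinrank := by exact_mod_cast h
  have := j.2
  omega

/-! ### Differentials of regular parameters -/

section Conormal

variable (k : Type*) [CommRing k] [Algebra k R]

/-- The cotangent space injects into the fibre of the module of differentials when the residue
field is formally smooth. -/
theorem mem_sq_of_D_mem [Algebra.FormallySmooth k (ResidueField R)] {x : R}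
    (hx : x ∈ maximalIdeal R)
    (hd : KaehlerDifferential.D k R x ∈ maximalIdeal R • (⊤ : Submodule R Ω[R⁄k])) :
    x ∈ maximalIdeal R ^ 2 := by
  set m := maximalIdeal R with hm
  have hle : m ^ 2 ≤ m := Ideal.pow_le_self two_ne_zero
  let π : (R ⧸ m ^ 2) →ₐ[k] ResidueField R := Ideal.Quotient.factorₐ k hle
  have hπ : Function.Surjective π := Ideal.Quotient.factor_surjective hle
  have hker : RingHom.ker (π : (R ⧸ m ^ 2) →+* ResidueField R) = m.map (Ideal.Quotient.mk _) := by
    exact Ideal.Quotient.factor_ker hle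
  have hnil : IsNilpotent (RingHom.ker (π : (R ⧸ m ^ 2) →+* ResidueField R)) := by
    refine ⟨2, ?_⟩
    rw [hker, ← Ideal.map_pow, Ideal.map_quotient_self]
    rfl
  -- The kernel of `π` has square zero, so formal smoothness of the residue field splits `π`.
  let σ : ResidueField R →ₐ[k] (R ⧸ m ^ 2) :=
    Algebra.FormallySmooth.liftOfSurjective (AlgHom.id k (ResidueField R)) π hπ hnil
  have hσ : ∀ a, π (σ a) = a := fun a =>
    Algebra.FormallySmooth.liftOfSurjective_apply (AlgHom.id k (ResidueField R)) π hπ hnil a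
  have hmul : ∀ a b : R ⧸ m ^ 2, π a = 0 → π b = 0 → a * b = 0 := by
    intro a b ha hb
    have ha' : a ∈ m.map (Ideal.Quotient.mk (m ^ 2)) := by rw [← hker]; exact ha
    have hb' : b ∈ m.map (Ideal.Quotient.mk (m ^ 2)) := by rw [← hker]; exact hb
    have := Ideal.mul_mem_mul ha' hb'
    rw [← Ideal.map_mul, ← pow_two, Ideal.map_quotient_self] at this
    exact this
  let f : R →+* R ⧸ m ^ 2 := Ideal.Quotient.mk _
  have hf : ∀ r, π (f r) = residue R r := fun r => rfl
  -- The difference of two ring maps that agree modulo $m$ is a derivation: $\delta(ab)=a\,\delta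
  -- b+b\,\delta a-\delta a\,\delta b$, and the last product vanishes. The induced linear map on
  -- $\Omega$ takes values in $m/m^2$, so it kills $m\Omega$, while it sends $dx$ to the class of
  -- $x$ when $x\in m$.
  let δ : R → R ⧸ m ^ 2 := fun r => f r - σ (residue R r)
  have hδ : ∀ r, π (δ r) = 0 := fun r => by simp [δ, hσ, hf]
  let D : Derivation k R (R ⧸ m ^ 2) := Derivation.mk'
    { toFun := δ
      map_add' := fun a b => by simp only [δ, map_add]; ring
      map_smul' := fun c a => by
        have h1 : f (c • a) = c • f a := rfl
        have h2 : residue R (c • a) = c • residue R a := rfl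
        simp only [δ, h1, h2, map_smul, smul_sub, RingHom.id_apply] }
    (fun a b => by
      have h : ∀ (r : R) (z : R ⧸ m ^ 2), r • z = f r * z := fun r z => by
        rw [Algebra.smul_def]; rfl
      have h3 := hmul _ _ (hδ a) (hδ b)
      simp only [LinearMap.coe_mk, AddHom.coe_mk, h]
      simp only [δ, map_mul] at h3 ⊢
      linear_combination -h3)
  let L := D.liftKaehlerDifferential
  have hL : ∀ ω, π (L ω) = 0 := by
    intro ω
    have : ω ∈ Submodule.span R (Set.range (KaehlerDifferential.D k R)) := by
      rw [KaehlerDifferential.span_range_derivation]; trivial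
    induction this using Submodule.span_induction with
    | mem y hy =>
      obtain ⟨r, rfl⟩ := hy
      rw [Derivation.liftKaehlerDifferential_comp_D]
      exact hδ r
    | zero => simp
    | add a b _ _ ha hb => simp [ha, hb]
    | smul a b _ hb =>
      rw [map_smul, Algebra.smul_def, map_mul, hb, mul_zero]
  have hL0 : ∀ ω ∈ m • (⊤ : Submodule R Ω[R⁄k]), L ω = 0 := by
    intro ω hω
    induction hω using Submodule.smul_induction_on' with
    | smul r hr n _ =>
      rw [map_smul, Algebra.smul_def]
      refine hmul _ _ ?_ (hL n)
      exact (residue_eq_zero_iff r).2 hr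
    | add a _ b _ ha hb => rw [map_add, ha, hb, add_zero]
  have h := hL0 _ hd
  rw [Derivation.liftKaehlerDifferential_comp_D] at h
  change f x - σ (residue R x) = 0 at h
  rw [(residue_eq_zero_iff x).2 hx, map_zero, sub_zero] at h
  exact Ideal.Quotient.eq_zero_iff_mem.1 h

variable [IsNoetherianRing R] [Algebra.FormallySmooth k (ResidueField R)]

/-- By Leibniz, $d(\sum c_it_i)\equiv\sum c_i\,dt_i$ modulo $m\Omega$, so $\sum c_it_i\in m^2$ and
minimality of the generators applies. -/
theorem mem_maximalIdeal_of_sum_D_mem {n : ℕ} {t : Fin n → R}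
    (ht : Ideal.span (Set.range t) = maximalIdeal R) (hn : ringKrullDim R = n)
    {c : Fin n → R}
    (hc : ∑ i, c i • KaehlerDifferential.D k R (t i) ∈ maximalIdeal R • (⊤ : Submodule R Ω[R⁄k]))
    (j : Fin n) : c j ∈ maximalIdeal R := by
  have htm : ∀ i, t i ∈ maximalIdeal R := fun i => ht ▸ Ideal.subset_span ⟨i, rfl⟩
  refine mem_maximalIdeal_of_sum_mem_sq ht hn (mem_sq_of_D_mem k ?_ ?_) j
  · exact Submodule.sum_mem _ fun i _ => Ideal.mul_mem_left _ _ (htm i)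
  · simp only [map_sum, Derivation.leibniz, Finset.sum_add_distrib]
    refine Submodule.add_mem _ hc (Submodule.sum_mem _ fun i _ => ?_)
    exact Submodule.smul_mem_smul (htm i) trivial

theorem mem_smul_top_of_repr_mem {R : Type*} [CommRing R] (k : Type*) [CommRing k] [Algebra k R]
    {ι : Type*} [Fintype ι] (e : Module.Basis ι R Ω[R⁄k]) {ω : Ω[R⁄k]} {I : Ideal R} (h : ∀ i, e.repr ω i ∈ I) :
    ω ∈ I • (⊤ : Submodule R Ω[R⁄k]) := by
  rw [← e.sum_repr ω]
  exact Submodule.sum_mem _ fun i _ => Submodule.smul_mem_smul (h i) trivial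

/-- A relation between the rows of the Jacobian matrix over the residue field lifts to $\sum
c_i\,dt_i\in m\Omega$. This one independence yields both the bound of the dimension by the rank and
the invertibility of the Jacobian. -/
theorem linearIndependent_residue_D {ι : Type*} [Fintype ι] (e : Module.Basis ι R Ω[R⁄k]) {n : ℕ} {t : Fin n → R}
    (ht : Ideal.span (Set.range t) = maximalIdeal R) (hn : ringKrullDim R = n) :
    LinearIndependent (ResidueField R) fun (i : Fin n) (j : ι) =>
      residue R (e.repr (KaehlerDifferential.D k R (t i)) j) := by
  rw [Fintype.linearIndependent_iff]
  intro g hg i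
  choose c hc using fun i => residue_surjective (R := R) (g i)
  rw [← hc i, residue_eq_zero_iff]
  refine mem_maximalIdeal_of_sum_D_mem k ht hn (mem_smul_top_of_repr_mem k e fun j => ?_) i
  rw [← residue_eq_zero_iff]
  have := congr_fun hg j
  simp only [Finset.sum_apply, Pi.smul_apply, smul_eq_mul, Pi.zero_apply] at this
  rw [← this]
  simp [hc]

/-- The dimension of a local ring is at most the rank of its module of differentials. -/
theorem dim_le_card_of_basis {ι : Type*} [Fintype ι] (e : Module.Basis ι R Ω[R⁄k]) {n : ℕ} {t : Fin n → R}
    (ht : Ideal.span (Set.range t) = maximalIdeal R) (hn : ringKrullDim R = n) :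
    n ≤ Fintype.card ι := by
  simpa using (linearIndependent_residue_D k e ht hn).fintype_card_le_finrank

/-- The differentials of regular parameters form a basis. -/
theorem isUnit_det_D_parameters {n : ℕ} (e : Module.Basis (Fin n) R Ω[R⁄k]) {t : Fin n → R}
    (ht : Ideal.span (Set.range t) = maximalIdeal R) (hn : ringKrullDim R = n) :
    IsUnit (e.det fun i => KaehlerDifferential.D k R (t i)) := by
  have h := linearIndependent_residue_D k e ht hn
  set A : Matrix (Fin n) (Fin n) R :=
    Matrix.of fun i j => e.repr (KaehlerDifferential.D k R (t i)) j with hA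
  have h' : IsUnit (A.map (residue R)) := by
    rw [← Matrix.linearIndependent_rows_iff_isUnit]
    exact h
  have h2 : IsUnit (residue R A.det) := by
    rw [RingHom.map_det]
    exact (Matrix.isUnit_iff_isUnit_det _).1 h'
  have h3 : IsUnit A.det := isUnit_of_map_unit (residue R) _ h2
  rwa [← Matrix.det_transpose] at h3

end Conormal

/-! ### Forms restricting to zero on a divisor -/

section RestrictionKernel

variable (k : Type*) [CommRing k] [Algebra k R]

/-- The kernel of the restriction of differentials to the closed point, when the maximal ideal is
principal. -/
theorem mem_of_map_residue_eq_zero {t : R} (ht : maximalIdeal R = Ideal.span {t}) {ω : Ω[R⁄k]}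
    (hω : KaehlerDifferential.map k k R (ResidueField R) ω = 0) :
    ω ∈ Ideal.span {t} • (⊤ : Submodule R Ω[R⁄k]) ⊔
      Submodule.span R {KaehlerDifferential.D k R t} := by
  have h0 : KaehlerDifferential.mapBaseChange k R (ResidueField R) (1 ⊗ₜ ω) = 0 := by
    rw [KaehlerDifferential.mapBaseChange_tmul, hω, smul_zero]
  -- Exactness of the conormal sequence: in the fibre of $\Omega$, the form $\omega$ equals $da$ for
  -- some $a\in m$. Writing $a=rt$ then gives $da=r\,dt+t\,dr$.
  obtain ⟨y, hy⟩ := (KaehlerDifferential.exact_kerCotangentToTensor_mapBaseChange k R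
    (ResidueField R) residue_surjective _).1 h0
  obtain ⟨⟨a, ha⟩, rfl⟩ := Ideal.toCotangent_surjective _ y
  rw [KaehlerDifferential.kerCotangentToTensor_toCotangent] at hy
  have ham : a ∈ maximalIdeal R := (residue_eq_zero_iff a).1 ha
  have h1 : ω - KaehlerDifferential.D k R a ∈ maximalIdeal R • (⊤ : Submodule R Ω[R⁄k]) := by
    have h2 : (1 : R ⧸ maximalIdeal R) ⊗ₜ[R] (ω - KaehlerDifferential.D k R a) = 0 := by
      rw [TensorProduct.tmul_sub, sub_eq_zero]
      exact hy.symm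
    have h3 := congr_arg (TensorProduct.quotTensorEquivQuotSMul Ω[R⁄k] (maximalIdeal R)) h2
    rw [map_zero, ← map_one (Ideal.Quotient.mk _),
      TensorProduct.quotTensorEquivQuotSMul_mk_tmul, one_smul] at h3
    exact (Submodule.Quotient.mk_eq_zero _).1 h3
  rw [ht] at ham h1
  obtain ⟨r, rfl⟩ := Ideal.mem_span_singleton'.1 ham
  rw [← sub_add_cancel ω (KaehlerDifferential.D k R (r * t))]
  refine Submodule.add_mem _ (Submodule.mem_sup_left h1) ?_
  rw [Derivation.leibniz]
  refine Submodule.add_mem _ (Submodule.mem_sup_right ?_) (Submodule.mem_sup_left ?_)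
  · exact Submodule.smul_mem _ _ (Submodule.mem_span_singleton_self _)
  · exact Submodule.smul_mem_smul (Ideal.mem_span_singleton_self t) trivial

end RestrictionKernel

/-! ### Rank-two lattices and determinants -/

section Lattice

variable {M : Type*} [AddCommGroup M] [Module R M]

/-- Cramer's rule in rank two, stated without dividing by the determinant. -/
theorem Basis.det_smul_eq {R M : Type*} [CommRing R] [AddCommGroup M] [Module R M]
    (e : Module.Basis (Fin 2) R M) (v w q : M) :
    e.det ![v, w] • q = e.det ![q, w] • v + e.det ![v, q] • w := by
  refine e.ext_elem fun i => ?_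
  simp only [Module.Basis.det_apply, Matrix.det_fin_two, Module.Basis.toMatrix_apply, map_add,
    map_smul, Finsupp.add_apply, Finsupp.smul_apply, smul_eq_mul, Matrix.cons_val_zero,
    Matrix.cons_val_one]
  fin_cases i <;> simp <;> ring

/-- A lattice `Q` of rank two is spanned by two vectors of any subset with the same ideal of
determinants. -/
theorem exists_le_span_pair_of_det [IsDomain R] (e : Module.Basis (Fin 2) R M) 
    {G : Set M} {Q : Submodule R M} (hG : G ⊆ Q) {d : R} (hd : d ≠ 0)
    (hdet : Ideal.span {r | ∃ v ∈ G, ∃ w ∈ G, r = e.det ![v, w]} = Ideal.span {d})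
    (hQ : ∀ v ∈ Q, ∀ w ∈ Q, e.det ![v, w] ∈ Ideal.span {d}) :
    ∃ v ∈ G, ∃ w ∈ G, e.det ![v, w] ≠ 0 ∧ Q ≤ Submodule.span R {v, w} := by
  obtain ⟨v, hv, w, hw, u, hu⟩ : ∃ v ∈ G, ∃ w ∈ G, ∃ u : Rˣ, e.det ![v, w] = u * d := by
    -- If every determinant were a nonunit multiple of `d`, they would all lie in $m\cdot(d)$, and
    -- Nakayama would force $d=0$.
    by_contra! hcon
    have hle : Ideal.span {d} ≤ maximalIdeal R • Ideal.span {d} := by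
      conv_lhs => rw [← hdet]
      rw [Ideal.span_le]
      rintro _ ⟨v, hv, w, hw, rfl⟩
      obtain ⟨c, hc⟩ := Ideal.mem_span_singleton'.1 (hQ v (hG hv) w (hG hw))
      rw [← hc]
      refine Ideal.mul_mem_mul ?_ (Ideal.mem_span_singleton_self d)
      by_contra hcm
      obtain ⟨u, rfl⟩ : IsUnit c := by simpa using hcm
      exact hcon v hv w hw u hc.symm
    have := Submodule.eq_bot_of_le_smul_of_le_jacobson_bot _ _
      (Submodule.fg_span (Set.finite_singleton d)) hle (maximalIdeal_le_jacobson _)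
    exact hd (Ideal.span_singleton_eq_bot.1 this)
  refine ⟨v, hv, w, hw, by rw [hu]; exact mul_ne_zero u.ne_zero hd, fun q hq => ?_⟩
  obtain ⟨a, ha⟩ := Ideal.mem_span_singleton'.1 (hQ q hq w (hG hw))
  obtain ⟨b, hb⟩ := Ideal.mem_span_singleton'.1 (hQ v (hG hv) q hq)
  have h := Basis.det_smul_eq e v w q
  have hinj : ∀ z : M, d • z = 0 → z = 0 := fun z hz => by
    refine e.ext_elem fun i => ?_
    have := congr_arg (fun z => e.repr z i) hz
    simpa [hd] using this
  -- In Cramer's rule all three determinants are divisible by `d`, which can be cancelled since the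
  -- module is free over a domain.
  have hq' : q = (↑u⁻¹ * a : R) • v + (↑u⁻¹ * b : R) • w := by
    rw [← sub_eq_zero]
    refine hinj _ ?_
    have h2 : d • q = (↑u⁻¹ : R) • (e.det ![v, w] • q) := by
      rw [hu, smul_smul, ← mul_assoc, Units.inv_mul, one_mul]
    rw [smul_sub, h2, h, ← ha, ← hb]
    module
  exact Submodule.mem_span_pair.2 ⟨_, _, hq'.symm⟩

end Lattice

/-! ### Hartogs for regular local rings of dimension at most two -/

section Regular

variable [IsNoetherianRing R] [IsDomain R]

/-- A minimal prime $p$ over $(s)$ has height at most one by Krull, so $t\notin p$. If $as+bt\in p$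
then $b\in p$, whence $p\subseteq(s)+mp$ and Nakayama gives $p=(s)$. The height is not zero because
$s=0$ would leave $m$ with one generator. -/
theorem prime_of_regular_parameter {s t : R} (hst : Ideal.span {s, t} = maximalIdeal R)
    (hdim : ringKrullDim R = 2) : (Ideal.span {s}).IsPrime ∧ (Ideal.span {s}).height = 1 := by
  have hmh : (maximalIdeal R).height = 2 := by
    have := IsLocalRing.maximalIdeal_height_eq_ringKrullDim (R := R)
    rw [hdim] at this
    exact WithBot.coe_injective this
  have hs : s ∈ maximalIdeal R := hst ▸ Ideal.subset_span (by simp)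
  have hsm : Ideal.span {s} ≤ maximalIdeal R := by simpa [Ideal.span_le] using hs
  have hm : maximalIdeal R ≠ ⊤ := Ideal.IsPrime.ne_top'
  have hs0 : s ≠ 0 := by
    rintro rfl
    have h : (maximalIdeal R).height ≤ (maximalIdeal R).spanFinrank :=
      Ideal.height_le_spanFinrank _ hm
    have h2 : (maximalIdeal R).spanFinrank ≤ 1 := by
      rw [← hst, Ideal.span_insert_zero]
      exact (Submodule.spanFinrank_span_le_ncard_of_finite (Set.finite_singleton t)).trans (by simp)
    rw [hmh] at h
    have : 2 ≤ (maximalIdeal R).spanFinrank := by exact_mod_cast h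
    omega
  obtain ⟨p, hp, hpm⟩ := Ideal.exists_minimalPrimes_le hsm
  have : p.IsPrime := hp.1.1
  have hp1 : p.height ≤ 1 := Ideal.height_le_one_of_isPrincipal_of_mem_minimalPrimes _ _ hp
  have hsp : Ideal.span {s} ≤ p := hp.1.2
  have htp : t ∉ p := fun h => by
    have : maximalIdeal R ≤ p := by
      rw [← hst, Ideal.span_le]
      rintro _ (rfl | rfl)
      · exact hsp (Ideal.mem_span_singleton_self _)
      · exact h
    have := Ideal.height_mono this
    rw [hmh] at this
    exact absurd (this.trans hp1) (by decide)
  have hps : p ≤ Ideal.span {s} := by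
    refine Submodule.le_of_le_smul_of_le_jacobson_bot (I := maximalIdeal R)
      (IsNoetherian.noetherian _) (maximalIdeal_le_jacobson _) fun x hx => ?_
    have hxm := hpm hx
    rw [← hst, Ideal.mem_span_pair] at hxm
    obtain ⟨a, b, rfl⟩ := hxm
    have hs' : a * s ∈ p := Ideal.mul_mem_left _ _ (hsp (Ideal.mem_span_singleton_self _))
    have hb : b ∈ p := (‹p.IsPrime›.mem_or_mem ((Submodule.add_mem_iff_right _ hs').1 hx)).resolve_right htp
    refine Submodule.add_mem_sup (Ideal.mul_mem_left _ _ (Ideal.mem_span_singleton_self _)) ?_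
    rw [mul_comm]
    exact Submodule.smul_mem_smul (hst ▸ Ideal.subset_span (by simp)) hb
  have hpe : p = Ideal.span {s} := le_antisymm hps hsp
  rw [← hpe]
  refine ⟨this, le_antisymm hp1 (Order.one_le_iff_pos.2 (pos_iff_ne_zero.2 fun h => ?_))⟩
  rw [Ideal.height_eq_zero_iff_eq_bot, hpe, Ideal.span_singleton_eq_bot] at h
  exact hs0 h

/-- Algebraic Hartogs lemma for regular local rings of dimension at most two. -/
theorem exists_algebraMap_eq_of_height_one {K : Type*} [Field K] [Algebra R K] [IsFractionRing R K]
    {n : ℕ} (hn2 : n ≤ 2) {t : Fin n → R} (ht : Ideal.span (Set.range t) = maximalIdeal R)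
    (hn : ringKrullDim R = n) {f : K}
    (hf : ∀ P : Ideal R, P.IsPrime → P.height = 1 → ∃ b ∉ P, ∃ a, algebraMap R K b * f = algebraMap R K a) :
    ∃ r, algebraMap R K r = f := by
  by_contra hcon
  have hmh : (maximalIdeal R).height = n := by
    have := IsLocalRing.maximalIdeal_height_eq_ringKrullDim (R := R)
    rw [hn] at this
    exact WithBot.coe_injective this
  -- A function is regular when its class in $K/R$ vanishes. Otherwise the annihilator of the class
  -- of `f` lies in an associated prime `P`. The height of `P` is not 1 by hypothesis, and not 0
  -- because a denominator of `f` annihilates its class. Hence the ring has dimension two and `P` is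
  -- maximal.
  let N := K ⧸ LinearMap.range (Algebra.linearMap R K)
  let q : K →ₗ[R] N := Submodule.mkQ _
  have hq : ∀ z, q z = 0 ↔ ∃ r, algebraMap R K r = z := fun z => by
    rw [← LinearMap.mem_ker, Submodule.ker_mkQ]
    rfl
  obtain ⟨P, hP, hfP⟩ := exists_le_isAssociatedPrime_of_isNoetherianRing R (q f)
    (fun h => hcon ((hq f).1 h))
  have hPp : P.IsPrime := hP.1
  have hP1 : P.height ≠ 1 := fun h => by
    obtain ⟨b, hb, a, hab⟩ := hf P hPp h
    refine hb (hfP ?_)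
    rw [Submodule.mem_colon_singleton, ← map_smul, Submodule.mem_bot, hq, Algebra.smul_def]
    exact ⟨a, hab.symm⟩
  have hP0 : P.height ≠ 0 := fun h => by
    rw [Ideal.height_eq_zero_iff_eq_bot] at h
    obtain ⟨a, b, hb, rfl⟩ := IsFractionRing.div_surjective (A := R) f
    refine nonZeroDivisors.ne_zero hb (h.le (hfP ?_))
    rw [Submodule.mem_colon_singleton, ← map_smul, Submodule.mem_bot, hq, Algebra.smul_def]
    refine ⟨a, (mul_div_cancel₀ _ ?_).symm⟩
    simpa using nonZeroDivisors.ne_zero hb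
  have hPm : P ≤ maximalIdeal R := le_maximalIdeal hPp.ne_top
  have hPn : P.height ≤ n := hmh ▸ Ideal.height_mono hPm
  obtain ⟨h, hh⟩ := ENat.ne_top_iff_exists.1 (ne_top_of_le_ne_top (ENat.natCast_ne_top n) hPn)
  rw [← hh] at hP0 hP1 hPn
  have hP0' : h ≠ 0 := by exact_mod_cast hP0
  have hP1' : h ≠ 1 := by exact_mod_cast hP1
  have hPn' : h ≤ n := by exact_mod_cast hPn
  obtain rfl : n = 2 := by omega
  have hPeq : P = maximalIdeal R := by
    refine hPm.eq_of_not_lt fun hlt => ?_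
    have : P.FiniteHeight := ⟨Or.inr (by rw [← hh]; exact ENat.natCast_ne_top h)⟩
    have := Ideal.height_strict_mono_of_isPrime hlt
    rw [← hh, hmh] at this
    have : h < 2 := by exact_mod_cast this
    omega
  -- The maximal ideal is now the annihilator of the class of some $g$: $t_0g=u$ and $t_1g=v$ lie in
  -- $R$, with $t_1u=t_0v$. As $t_0$ is prime and does not divide $t_1$, it divides $u$, so $g\in R$
  -- and its annihilator is the whole ring, a contradiction.
  obtain ⟨-, x, hx⟩ := (isAssociatedPrime_iff).1 hP
  obtain ⟨g, rfl⟩ := Submodule.mkQ_surjective _ x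
  have hmem : ∀ r ∈ maximalIdeal R, ∃ a, algebraMap R K a = algebraMap R K r * g := fun r hr => by
    rw [← hPeq, hx, Submodule.mem_colon_singleton, ← map_smul, Submodule.mem_bot] at hr
    simpa [Algebra.smul_def] using (hq _).1 hr
  have htm : ∀ i, t i ∈ maximalIdeal R := fun i => ht ▸ Ideal.subset_span ⟨i, rfl⟩
  have hst : Ideal.span {t 0, t 1} = maximalIdeal R := by
    rw [← ht]
    congr 1
    ext z
    simp [Fin.exists_fin_two, eq_comm]
  obtain ⟨hp, hp1⟩ := prime_of_regular_parameter hst hn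
  obtain ⟨u, hu⟩ := hmem _ (htm 0)
  obtain ⟨v, hv⟩ := hmem _ (htm 1)
  have huv : t 1 * u = t 0 * v := by
    apply IsFractionRing.injective R K
    rw [map_mul, map_mul, hu, hv]
    ring
  have ht1 : t 1 ∉ Ideal.span {t 0} := fun h => by
    have hle : maximalIdeal R ≤ Ideal.span {t 0} := by
      rw [← hst, Ideal.span_le]
      rintro _ (rfl | rfl)
      · exact Ideal.mem_span_singleton_self _
      · exact h
    have h2 := Ideal.height_mono hle
    rw [hmh, hp1] at h2
    exact absurd h2 (by decide)
  have hu0 : u ∈ Ideal.span {t 0} := by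
    refine (hp.mem_or_mem (?_ : t 1 * u ∈ _)).resolve_left ht1
    rw [huv]
    exact Ideal.mul_mem_right _ _ (Ideal.mem_span_singleton_self _)
  obtain ⟨c, rfl⟩ := Ideal.mem_span_singleton'.1 hu0
  have ht0 : algebraMap R K (t 0) ≠ 0 := fun h => by
    rw [map_eq_zero_iff _ (IsFractionRing.injective R K)] at h
    rw [h, Ideal.span_singleton_eq_bot.2 rfl, Ideal.height_bot] at hp1
    exact absurd hp1 (by decide)
  have hgc : algebraMap R K c = g := by
    rw [map_mul, mul_comm] at hu
    exact mul_left_cancel₀ ht0 hu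
  refine hPp.ne_top ((Ideal.eq_top_iff_one _).2 ?_)
  rw [hx, Submodule.mem_colon_singleton, one_smul, Submodule.mem_bot]
  exact (hq g).2 ⟨c, hgc⟩

end Regular
end LocalAlgebra

/-! ### Local rings inside the function field -/

section RationalFunctions

variable {S : Scheme.{0}}

/-- The prime ideal of the local ring at `x` given by a generization `p` of `x`. -/
def generizationIdeal {p x : S} (h : p ⤳ x) : Ideal (S.presheaf.stalk x) :=
  (IsLocalRing.maximalIdeal (S.presheaf.stalk p)).comap (S.presheaf.stalkSpecializes h).hom

instance {p x : S} (h : p ⤳ x) : (generizationIdeal h).IsPrime :=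
  inferInstanceAs ((IsLocalRing.maximalIdeal (S.presheaf.stalk p)).comap
    (S.presheaf.stalkSpecializes h).hom).IsPrime

/-- With `exists_generizationIdeal_eq`, this matches the primes of the local ring at `x` with the
generizations of `x`. -/
theorem fromSpecStalk_generizationIdeal {p x : S} (h : p ⤳ x) :
    S.fromSpecStalk x ⟨generizationIdeal h, inferInstance⟩ = p := by
  have h1 : S.fromSpecStalk x (Spec.map (S.presheaf.stalkSpecializes h)
      (IsLocalRing.closedPoint (S.presheaf.stalk p))) =
      S.fromSpecStalk p (IsLocalRing.closedPoint (S.presheaf.stalk p)) :=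
    congr_arg (fun f => f (IsLocalRing.closedPoint (S.presheaf.stalk p)))
      (Scheme.SpecMap_stalkSpecializes_fromSpecStalk h)
  rw [Scheme.fromSpecStalk_closedPoint] at h1
  exact h1

theorem eq_of_generizationIdeal_eq {p q x : S} (h : p ⤳ x) (h' : q ⤳ x)
    (e : generizationIdeal h = generizationIdeal h') : p = q := by
  rw [← fromSpecStalk_generizationIdeal h, ← fromSpecStalk_generizationIdeal h']
  congr 1
  exact PrimeSpectrum.ext e

theorem exists_generizationIdeal_eq (x : S) (P : Ideal (S.presheaf.stalk x)) (hP : P.IsPrime) :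
    ∃ (p : S) (h : p ⤳ x), generizationIdeal h = P := by
  have h : S.fromSpecStalk x ⟨P, hP⟩ ⤳ x := by
    have : S.fromSpecStalk x ⟨P, hP⟩ ∈ Set.range (S.fromSpecStalk x) := ⟨_, rfl⟩
    rw [Scheme.range_fromSpecStalk] at this
    exact this
  refine ⟨_, h, ?_⟩
  have h1 := fromSpecStalk_generizationIdeal h
  have h2 := (S.fromSpecStalk x).isEmbedding.injective h1
  exact congr_arg PrimeSpectrum.asIdeal h2

variable [IsIntegral S]

theorem algebraMap_stalkSpecializes {p x : S} (h : p ⤳ x) (a : S.presheaf.stalk x) :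
    algebraMap (S.presheaf.stalk p) S.functionField (S.presheaf.stalkSpecializes h a) =
      algebraMap (S.presheaf.stalk x) S.functionField a :=
  S.presheaf.stalkSpecializes_comp_apply _ _ _

theorem stalk_algebraMap_injective (x : S) :
    Function.Injective (algebraMap (S.presheaf.stalk x) S.functionField) :=
  IsFractionRing.injective _ _

/-- An affine neighbourhood of `x` also contains `p`, and the local ring at `p` is a localization of
its functions. So every germ at `p` is a fraction of germs coming from `x`, and injectivity is
tested in the function field. -/
theorem isLocalization_stalkSpecializes {p x : S} (h : p ⤳ x) :
    letI := (S.presheaf.stalkSpecializes h).hom.toAlgebra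
    IsLocalization.AtPrime (S.presheaf.stalk p) (generizationIdeal h) := by
  let := (S.presheaf.stalkSpecializes h).hom.toAlgebra
  have hinj : Function.Injective (S.presheaf.stalkSpecializes h) := fun a b hab => by
    apply stalk_algebraMap_injective x
    rw [← algebraMap_stalkSpecializes h, hab, algebraMap_stalkSpecializes]
  have hunit : ∀ a, a ∉ generizationIdeal h → IsUnit (S.presheaf.stalkSpecializes h a) := by
    intro a ha
    have : S.presheaf.stalkSpecializes h a ∉ IsLocalRing.maximalIdeal (S.presheaf.stalk p) := ha
    simpa using this
  refine ⟨fun a => hunit a a.2, fun z => ?_, fun {a b} hab => ⟨1, by rw [hinj hab]⟩⟩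
  obtain ⟨_, ⟨W, hW, rfl⟩, hxW, -⟩ :=
    S.isBasis_affineOpens.exists_subset_of_mem_open (Set.mem_univ x) isOpen_univ
  have hpW : p ∈ W := h.mem_open W.isOpen hxW
  let _ := TopCat.Presheaf.algebra_section_stalk S.presheaf (⟨p, hpW⟩ : W)
  have := hW.isLocalization_stalk ⟨p, hpW⟩
  obtain ⟨⟨a, s⟩, has⟩ := IsLocalization.surj
    (hW.primeIdealOf ⟨p, hpW⟩).asIdeal.primeCompl z
  have hgerm : ∀ r : Γ(S, W), S.presheaf.stalkSpecializes h (S.presheaf.germ W x hxW r) =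
      S.presheaf.germ W p hpW r := fun r => S.presheaf.germ_stalkSpecializes_apply hxW h r
  have hs : S.presheaf.germ W x hxW s.1 ∉ generizationIdeal h := fun hs => by
    have h1 : S.presheaf.germ W p hpW s.1 ∈ IsLocalRing.maximalIdeal (S.presheaf.stalk p) := by
      rw [← hgerm]; exact hs
    have h2 : IsUnit (S.presheaf.germ W p hpW s.1) :=
      IsLocalization.map_units (S.presheaf.stalk p) s
    exact h1 h2
  refine ⟨⟨S.presheaf.germ W x hxW a, S.presheaf.germ W x hxW s.1, hs⟩, ?_⟩
  have : z * S.presheaf.germ W p hpW s.1 = S.presheaf.germ W p hpW a := has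
  rw [← hgerm, ← hgerm] at this
  exact this

theorem ringKrullDim_stalk_eq_height {p x : S} (h : p ⤳ x) :
    ringKrullDim (S.presheaf.stalk p) = (generizationIdeal h).height := by
  let := (S.presheaf.stalkSpecializes h).hom.toAlgebra
  have := isLocalization_stalkSpecializes h
  exact IsLocalization.AtPrime.ringKrullDim_eq_height (generizationIdeal h) _

/-- The rational functions that are regular at `x`. -/
def regularAt (x : S) : Subring S.functionField :=
  (algebraMap (S.presheaf.stalk x) S.functionField).range

/-- A section of the structure sheaf, as a rational function. -/
theorem algebraMap_germ_eq {W : S.Opens} {x y : S} (hx : x ∈ W) (hy : y ∈ W) (f : Γ(S, W)) :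
    algebraMap (S.presheaf.stalk x) S.functionField (S.presheaf.germ W x hx f) =
      algebraMap (S.presheaf.stalk y) S.functionField (S.presheaf.germ W y hy f) := by
  have : Nonempty W := ⟨⟨x, hx⟩⟩
  rw [Scheme.algebraMap_germ_eq_germToFunctionField, Scheme.algebraMap_germ_eq_germToFunctionField]

theorem section_ext {W : S.Opens} {f g : Γ(S, W)}
    (h : ∀ (y : S) (hy : y ∈ W),
      algebraMap (S.presheaf.stalk y) S.functionField (S.presheaf.germ W y hy f) =
        algebraMap (S.presheaf.stalk y) S.functionField (S.presheaf.germ W y hy g)) : f = g :=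
  TopCat.Presheaf.section_ext S.sheaf W f g fun y hy => stalk_algebraMap_injective y (h y hy)

theorem exists_section_of_mem_regularAt {x : S} {g : S.functionField} (hg : g ∈ regularAt x) :
    ∃ (W : S.Opens) (_ : x ∈ W) (f : Γ(S, W)), ∀ (y : S) (hy : y ∈ W),
      algebraMap (S.presheaf.stalk y) S.functionField (S.presheaf.germ W y hy f) = g := by
  obtain ⟨a, rfl⟩ := hg
  obtain ⟨W, hxW, f, rfl⟩ := S.presheaf.exists_germ_eq a
  exact ⟨W, hxW, f, fun y hy => algebraMap_germ_eq hy hxW f⟩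

theorem exists_section_of_forall_mem_regularAt {W : S.Opens} {g : S.functionField}
    (hg : ∀ y ∈ W, g ∈ regularAt y) : ∃ f : Γ(S, W), ∀ (y : S) (hy : y ∈ W),
      algebraMap (S.presheaf.stalk y) S.functionField (S.presheaf.germ W y hy f) = g := by
  choose! U hxU f hf using fun y : W => exists_section_of_mem_regularAt (hg y y.2)
  obtain ⟨s, hs, -⟩ := S.sheaf.existsUnique_gluing' (fun y : W => U y ⊓ W) W
    (fun y => homOfLE inf_le_right) (fun y hy => Opens.mem_iSup.2 ⟨⟨y, hy⟩, hxU ⟨y, hy⟩, hy⟩)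
    (fun y => S.presheaf.map (homOfLE inf_le_left).op (f y)) (by
      intro i j
      refine section_ext fun y hy => ?_
      erw [TopCat.Presheaf.germ_res_apply, TopCat.Presheaf.germ_res_apply,
        TopCat.Presheaf.germ_res_apply, TopCat.Presheaf.germ_res_apply]
      rw [hf, hf])
  refine ⟨s, fun y hy => ?_⟩
  have h1 := congr_arg (S.presheaf.germ (U ⟨y, hy⟩ ⊓ W) y ⟨hxU ⟨y, hy⟩, hy⟩) (hs ⟨y, hy⟩)
  erw [TopCat.Presheaf.germ_res_apply, TopCat.Presheaf.germ_res_apply] at h1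
  refine (congr_arg _ h1).trans (hf _ _ _)

variable (S) in
/-- All local rings of `S` are regular of dimension at most two. -/
def HasRegularStalks : Prop :=
  ∀ x : S, ∃ (n : ℕ) (t : Fin n → S.presheaf.stalk x), n ≤ 2 ∧
    ringKrullDim (S.presheaf.stalk x) = n ∧
    Ideal.span (Set.range t) = IsLocalRing.maximalIdeal (S.presheaf.stalk x)

/-- The height-one primes of the local ring at `x` are the prime divisors through `x`, and
regularity along one of them provides a denominator outside the corresponding prime. -/
theorem mem_regularAt_of_forall_primeDivisor [IsLocallyNoetherian S] (hS : HasRegularStalks S)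
    {x : S} {g : S.functionField}
    (hg : ∀ p : S, p ⤳ x → ringKrullDim (S.presheaf.stalk p) = 1 → g ∈ regularAt p) :
    g ∈ regularAt x := by
  obtain ⟨n, t, hn2, hn, ht⟩ := hS x
  refine exists_algebraMap_eq_of_height_one hn2 ht hn fun P hP hP1 => ?_
  obtain ⟨p, h, rfl⟩ := exists_generizationIdeal_eq x P hP
  have hp : ringKrullDim (S.presheaf.stalk p) = 1 := by
    rw [ringKrullDim_stalk_eq_height h, hP1]
    rfl
  obtain ⟨z, rfl⟩ := hg p h hp
  let := (S.presheaf.stalkSpecializes h).hom.toAlgebra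
  have := isLocalization_stalkSpecializes h
  obtain ⟨⟨a, s⟩, has⟩ := IsLocalization.surj (generizationIdeal h).primeCompl z
  refine ⟨s, s.2, a, ?_⟩
  have has' : z * S.presheaf.stalkSpecializes h s.1 = S.presheaf.stalkSpecializes h a := has
  have h2 := congr_arg (algebraMap (S.presheaf.stalk p) S.functionField) has'
  rw [map_mul, algebraMap_stalkSpecializes, algebraMap_stalkSpecializes] at h2
  rw [mul_comm]
  exact h2

/-- Two prime divisors such that one specializes to the other are equal. -/
theorem eq_of_specializes_of_dim_eq_one {p q : S} (h : p ⤳ q)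
    (hp : ringKrullDim (S.presheaf.stalk p) = 1) (hq : ringKrullDim (S.presheaf.stalk q) = 1) :
    p = q := by
  have h1 := ringKrullDim_stalk_eq_height h
  have h2 := ringKrullDim_stalk_eq_height (specializes_refl q)
  rw [hp] at h1
  rw [hq] at h2
  refine eq_of_generizationIdeal_eq h (specializes_refl q) ?_
  have hle : generizationIdeal h ≤ generizationIdeal (specializes_refl q) := by
    have : generizationIdeal (specializes_refl q) = IsLocalRing.maximalIdeal (S.presheaf.stalk q) := by
      ext a
      simp [generizationIdeal]
    rw [this]
    exact IsLocalRing.le_maximalIdeal (Ideal.IsPrime.ne_top inferInstance)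
  have h1' : (generizationIdeal h).height = 1 := (WithBot.coe_injective h1).symm
  have h2' : (generizationIdeal (specializes_refl q)).height = 1 := (WithBot.coe_injective h2).symm
  refine hle.eq_of_not_lt fun hlt => ?_
  have : (generizationIdeal h).FiniteHeight := ⟨Or.inr (by rw [h1']; decide)⟩
  have := Ideal.height_strict_mono_of_isPrime hlt
  rw [h1', h2'] at this
  exact lt_irrefl _ this

/-- Near a prime divisor, a rational function has no pole but possibly that divisor. -/
theorem exists_open_forall_mem_regularAt [IsLocallyNoetherian S] (g : S.functionField) {p : S}
    (hp : ringKrullDim (S.presheaf.stalk p) = 1) :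
    ∃ W : S.Opens, p ∈ W ∧ ∀ q ∈ W, ringKrullDim (S.presheaf.stalk q) = 1 → q ≠ p →
      g ∈ regularAt q := by
  obtain ⟨_, ⟨A, hA, rfl⟩, hpA, -⟩ :=
    S.isBasis_affineOpens.exists_subset_of_mem_open (Set.mem_univ p) isOpen_univ
  have : Nonempty A := ⟨⟨p, hpA⟩⟩
  have := functionField_isFractionRing_of_isAffineOpen S A hA
  have : IsNoetherianRing Γ(S, A) := IsLocallyNoetherian.component_noetherian ⟨A, hA⟩
  obtain ⟨a, b, hb, rfl⟩ := IsFractionRing.div_surjective (A := Γ(S, A)) g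
  have hb0 : b ≠ 0 := nonZeroDivisors.ne_zero hb
  let P : A → Ideal Γ(S, A) := fun q => (hA.primeIdealOf q).asIdeal
  have hPinj : Function.Injective P := fun q q' h => by
    have h1 := congr_arg hA.fromSpec (PrimeSpectrum.ext h)
    rw [hA.fromSpec_primeIdealOf, hA.fromSpec_primeIdealOf] at h1
    exact Subtype.ext h1
  have hbP : ∀ q : A, b ∉ P q → algebraMap _ S.functionField a / algebraMap _ _ b ∈
      regularAt q.1 := by
    intro q hq
    let _ := TopCat.Presheaf.algebra_section_stalk S.presheaf q
    have := hA.isLocalization_stalk q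
    obtain ⟨u, hu⟩ : IsUnit (S.presheaf.germ A q.1 q.2 b) :=
      IsLocalization.map_units (S.presheaf.stalk q.1) (⟨b, hq⟩ : (P q).primeCompl)
    refine ⟨S.presheaf.germ A q.1 q.2 a * ↑u⁻¹, ?_⟩
    have h1 : ∀ f : Γ(S, A), algebraMap (S.presheaf.stalk q.1) S.functionField
        (S.presheaf.germ A q.1 q.2 f) = algebraMap Γ(S, A) S.functionField f :=
      fun f => Scheme.algebraMap_germ_eq_germToFunctionField _ q.2 f
    rw [map_mul, h1, div_eq_mul_inv]
    congr 1
    refine eq_inv_of_mul_eq_one_left ?_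
    rw [← h1, ← hu, ← map_mul, Units.inv_mul, map_one]
  have hPmin : ∀ q : A, ringKrullDim (S.presheaf.stalk q.1) = 1 → b ∈ P q →
      P q ∈ (Ideal.span {b}).minimalPrimes := by
    intro q hq hbq
    let _ := TopCat.Presheaf.algebra_section_stalk S.presheaf q
    have := hA.isLocalization_stalk q
    have h1 := IsLocalization.AtPrime.ringKrullDim_eq_height (P q) (S.presheaf.stalk q.1)
    rw [hq] at h1
    have h2 : (P q).height = 1 := (WithBot.coe_injective h1).symm
    refine Ideal.mem_minimalPrimes_of_height_le ((Ideal.span_singleton_le_iff_mem _).2 hbq) ?_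
    rw [h2]
    exact Ideal.one_le_height_span_singleton_of_mem_nonZeroDivisors hb
  -- The possible polar divisors other than `p`. They correspond to minimal primes over the
  -- denominator, so there are finitely many, and none of their closures contains `p`.
  let T : Set A := {q | ringKrullDim (S.presheaf.stalk q.1) = 1 ∧ q.1 ≠ p ∧ b ∈ P q}
  have hT : T.Finite := by
    refine Set.Finite.of_finite_image (f := P) ?_ hPinj.injOn
    refine (Ideal.finite_minimalPrimes_of_isNoetherianRing _ (Ideal.span {b})).subset ?_
    rintro _ ⟨q, hq, rfl⟩
    exact hPmin q hq.1 hq.2.2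
  have hcl : IsClosed (⋃ q ∈ T, closure {q.1}) := hT.isClosed_biUnion fun _ _ => isClosed_closure
  refine ⟨A ⊓ ⟨_, hcl.isOpen_compl⟩, ⟨hpA, ?_⟩, fun q hqW hq hqp => ?_⟩
  · rintro h
    simp only [Set.mem_iUnion] at h
    obtain ⟨q, hq, hqp⟩ := h
    exact hq.2.1 (eq_of_specializes_of_dim_eq_one (specializes_iff_mem_closure.2 hqp) hq.1 hp)
  · refine hbP ⟨q, hqW.1⟩ fun hbq => hqW.2 ?_
    exact Set.mem_biUnion (show (⟨q, hqW.1⟩ : A) ∈ T from ⟨hq, hqp, hbq⟩) (subset_closure rfl)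

end RationalFunctions

/-! ### Differentials on a smooth surface -/

section SmoothSurface

variable (S : Scheme.{0}) [S.Over (Spec (.of ℂ))]

theorem exists_affine_constants_isStandardSmooth
    [SmoothOfRelativeDimension 2 (S ↘ Spec (.of ℂ))] (x : S) :
    ∃ W : S.Opens, x ∈ W ∧ IsAffineOpen W ∧
      (constants S W).IsStandardSmoothOfRelativeDimension 2 := by
  obtain ⟨U, hU, W, hW, hxW, e, h⟩ :=
    SmoothOfRelativeDimension.exists_isStandardSmoothOfRelativeDimension (n := 2)
      (f := S ↘ Spec (.of ℂ)) x
  -- The spectrum of $\mathbb{C}$ has a single point.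
  obtain rfl : U = ⊤ := by
    rw [eq_top_iff]
    rintro z -
    have hs : Subsingleton (Spec (.of ℂ) : Scheme) :=
      inferInstanceAs (Subsingleton (PrimeSpectrum ℂ))
    have : (S ↘ Spec (.of ℂ)) x ∈ U := e hxW
    rwa [Subsingleton.elim z]
  refine ⟨W, hxW, hW, ?_⟩
  have h2 := h.comp (RingHom.IsStandardSmoothOfRelativeDimension.equiv
    (Scheme.ΓSpecIso (.of ℂ)).symm.commRingCatIsoToRingEquiv)
  have h3 : constants S W = ((S ↘ Spec (.of ℂ)).appLE ⊤ W e).hom.comp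
      ((Scheme.ΓSpecIso (.of ℂ)).symm.commRingCatIsoToRingEquiv : ℂ →+* _) := by
    ext c
    rfl
  rw [h3]
  exact h2

variable {S}

section Affine

variable (W : S.Opens)

/-- The `ℂ`-algebra of functions on an open. -/
abbrev sectionAlgebra : Algebra ℂ Γ(S, W) := (constants S W).toAlgebra

/-- The algebra structure of a local ring over the functions on an open. -/
abbrev germAlgebra {W : S.Opens} {y : S} (hy : y ∈ W) : Algebra Γ(S, W) (S.presheaf.stalk y) :=
  (S.presheaf.germ W y hy).hom.toAlgebra

theorem isScalarTower_germ {W : S.Opens} {y : S} (hy : y ∈ W) :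
    letI := sectionAlgebra W
    letI := germAlgebra hy
    IsScalarTower ℂ Γ(S, W) (S.presheaf.stalk y) := by
  let := sectionAlgebra W
  let := germAlgebra hy
  exact .of_algebraMap_eq fun c => (germ_constants S y hy c).symm

/-- The germ of a differential form on an affine open. -/
def formGerm {W : S.Opens} {y : S} (hy : y ∈ W) :
    letI := sectionAlgebra W
    letI := germAlgebra hy
    Ω[Γ(S, W)⁄ℂ] →ₗ[Γ(S, W)] FormStalk S y :=
  letI := sectionAlgebra W
  letI := germAlgebra hy
  have := isScalarTower_germ hy
  KaehlerDifferential.map ℂ ℂ Γ(S, W) (S.presheaf.stalk y)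

end Affine

variable [SmoothOfRelativeDimension 2 (S ↘ Spec (.of ℂ))]

/-- Locally on a smooth surface, the sheaf of differentials is free of rank two. -/
theorem exists_frame (x : S) : ∃ (W : S.Opens) (_ : x ∈ W)
    (e : Fin 2 → formSections (S := S) (fun _ => ⊤) W), ∀ (y : S) (hy : y ∈ W),
      ∃ b : Module.Basis (Fin 2) (S.presheaf.stalk y) (FormStalk S y),
        ∀ i, b i = (e i).1 ⟨y, hy⟩ := by
  obtain ⟨W, hxW, hW, hsm⟩ := exists_affine_constants_isStandardSmooth S x
  let _ := sectionAlgebra W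
  have hsm' : Algebra.IsStandardSmoothOfRelativeDimension 2 ℂ Γ(S, W) := hsm
  have : Algebra.IsStandardSmooth ℂ Γ(S, W) := hsm'.isStandardSmooth 2
  have : Nonempty W := ⟨⟨x, hxW⟩⟩
  have hnt : Nontrivial Γ(S, W) := inferInstance
  have hr := Algebra.IsStandardSmoothOfRelativeDimension.rank_kaehlerDifferential
    (R := ℂ) (S := Γ(S, W)) 2
  have : Module.Finite Γ(S, W) Ω[Γ(S, W)⁄ℂ] := Module.finite_of_rank_eq_nat hr
  let b := Module.finBasisOfFinrankEq Γ(S, W) Ω[Γ(S, W)⁄ℂ] (Module.finrank_eq_of_rank_eq hr)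
  have hform : ∀ ω : Ω[Γ(S, W)⁄ℂ], IsForm (U := W) fun y => formGerm y.2 ω := by
    intro ω z hz
    have hω : ω ∈ Submodule.span Γ(S, W) (Set.range (KaehlerDifferential.D ℂ Γ(S, W))) := by
      rw [KaehlerDifferential.span_range_derivation]; trivial
    obtain ⟨n, a, g, hg⟩ := Submodule.mem_span_set'.1 hω
    choose c hc using fun i => (g i).2
    refine ⟨W, le_rfl, hz, n, a, c, fun y hy => ?_⟩
    let _ := germAlgebra hy
    have := isScalarTower_germ hy
    change formGerm hy ω = _
    rw [← hg, map_sum]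
    refine Finset.sum_congr rfl fun i _ => ?_
    rw [map_smul, ← hc i]
    refine (algebraMap_smul (S.presheaf.stalk y) (a i) _).symm.trans ?_
    congr 1
    exact KaehlerDifferential.map_D ℂ ℂ Γ(S, W) (S.presheaf.stalk y) (c i)
  refine ⟨W, hxW, fun i => ⟨_, hform (b i), fun _ => trivial⟩, fun y hy => ?_⟩
  let _ := germAlgebra hy
  have := isScalarTower_germ hy
  have hloc : IsLocalization.AtPrime (S.presheaf.stalk y) (hW.primeIdealOf ⟨y, hy⟩).asIdeal :=
    hW.isLocalization_stalk ⟨y, hy⟩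
  refine ⟨b.ofIsLocalizedModule (S.presheaf.stalk y) (hW.primeIdealOf ⟨y, hy⟩).asIdeal.primeCompl
    (KaehlerDifferential.map ℂ ℂ Γ(S, W) (S.presheaf.stalk y)), fun i => ?_⟩
  rw [Module.Basis.ofIsLocalizedModule_apply]
  rfl

theorem exists_stalk_basis (x : S) :
    Nonempty (Module.Basis (Fin 2) (S.presheaf.stalk x) (FormStalk S x)) := by
  obtain ⟨W, hxW, e, he⟩ := exists_frame x
  obtain ⟨b, -⟩ := he x hxW
  exact ⟨b⟩

/-- The residue field is essentially of finite type over $\mathbb{C}$, which is perfect. This is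
what the splitting in `mem_sq_of_D_mem` requires, also at non-closed points. -/
theorem residueField_formallySmooth (x : S) :
    Algebra.FormallySmooth ℂ (IsLocalRing.ResidueField (S.presheaf.stalk x)) := by
  obtain ⟨W, hxW, hW, hsm⟩ := exists_affine_constants_isStandardSmooth S x
  let _ := sectionAlgebra W
  let _ := germAlgebra hxW
  have := isScalarTower_germ hxW
  have hsm' : Algebra.IsStandardSmoothOfRelativeDimension 2 ℂ Γ(S, W) := hsm
  have : Algebra.IsStandardSmooth ℂ Γ(S, W) := hsm'.isStandardSmooth 2
  have hloc : IsLocalization.AtPrime (S.presheaf.stalk x) (hW.primeIdealOf ⟨x, hxW⟩).asIdeal :=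
    hW.isLocalization_stalk ⟨x, hxW⟩
  have h1 : Algebra.EssFiniteType Γ(S, W) (S.presheaf.stalk x) :=
    Algebra.EssFiniteType.of_isLocalization _ (hW.primeIdealOf ⟨x, hxW⟩).asIdeal.primeCompl
  have h2 : Algebra.EssFiniteType ℂ (S.presheaf.stalk x) :=
    Algebra.EssFiniteType.comp ℂ Γ(S, W) _
  have h3 : Algebra.EssFiniteType ℂ (IsLocalRing.ResidueField (S.presheaf.stalk x)) :=
    Algebra.EssFiniteType.comp ℂ (S.presheaf.stalk x) _
  infer_instance

variable (S) in
theorem isLocallyNoetherian_of_smooth : IsLocallyNoetherian S := by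
  have := SmoothOfRelativeDimension.smooth 2 (S ↘ Spec (.of ℂ))
  exact LocallyOfFiniteType.isLocallyNoetherian (S ↘ Spec (.of ℂ))

end SmoothSurface

/-! ### Regular forms inside the rational forms -/

section RationalForms

variable {S : Scheme.{0}} [S.Over (Spec (.of ℂ))] [IsIntegral S]

theorem isLocalizedModule_toRational (x : S) :
    IsLocalizedModule (nonZeroDivisors (S.presheaf.stalk x)) (toRational x) :=
  KaehlerDifferential.isLocalizedModule_map ℂ (S.presheaf.stalk x) S.functionField _

theorem toRational_D (x : S) (a : S.presheaf.stalk x) :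
    toRational x (KaehlerDifferential.D ℂ _ a) =
      KaehlerDifferential.D ℂ S.functionField (algebraMap _ S.functionField a) :=
  KaehlerDifferential.map_D _ _ _ _ _

theorem toRational_smul (x : S) (a : S.presheaf.stalk x) (ω : FormStalk S x) :
    toRational x (a • ω) = algebraMap _ S.functionField a • toRational x ω := by
  rw [map_smul, algebraMap_smul]

/-- Each local expression $\sum a_i\,db_i$ is also valid at the generic point, so every germ is
compared with the germ there. -/
theorem toRational_form_eq {U : S.Opens} {s : ∀ x : U, FormStalk S x.1} (hs : IsForm s) (x y : U) :
    toRational x.1 (s x) = toRational y.1 (s y) := by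
  have key : ∀ x : U, ∃ hη : genericPoint S ∈ U,
      toRational x.1 (s x) = toRational (genericPoint S) (s ⟨genericPoint S, hη⟩) := by
    intro x
    obtain ⟨W, hW, hxW, n, a, b, h⟩ := hs x.1 x.2
    have hη : genericPoint S ∈ W := ((genericPoint_spec S).mem_open_set_iff W.isOpen).2
      ⟨x.1, trivial, hxW⟩
    refine ⟨hW hη, ?_⟩
    have h1 := h x.1 hxW
    rw [h1, h _ hη, map_sum, map_sum]
    refine Finset.sum_congr rfl fun i _ => ?_
    rw [toRational_smul, toRational_smul, toRational_D, toRational_D,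
      algebraMap_germ_eq hxW hη, algebraMap_germ_eq hxW hη]
  exact (key x).choose_spec.trans (key y).choose_spec.symm

/-- The rational form defined by a global form. -/
def GlobalForms.rational (ω : GlobalForms S) : Ω[S.functionField⁄ℂ] :=
  toRational (genericPoint S) (ω.germ (genericPoint S))

theorem toRational_globalForm (x : S) (ω : GlobalForms S) :
    toRational x (ω.germ x) = ω.rational :=
  toRational_form_eq ω.2.1 ⟨x, trivial⟩ ⟨genericPoint S, trivial⟩

theorem repr_toRational {y : S} {b : Module.Basis (Fin 2) (S.presheaf.stalk y) (FormStalk S y)}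
    {E : Module.Basis (Fin 2) S.functionField Ω[S.functionField⁄ℂ]}
    (h : ∀ i, toRational y (b i) = E i) (ω : FormStalk S y) (i : Fin 2) :
    E.repr (toRational y ω) i = algebraMap _ S.functionField (b.repr ω i) := by
  conv_lhs => rw [← b.sum_repr ω]
  rw [map_sum]
  simp_rw [toRational_smul, h]
  simp_rw [map_sum, map_smul, Module.Basis.repr_self, Finsupp.finsetSum_apply, Finsupp.smul_apply,
    smul_eq_mul, Finsupp.single_apply, mul_ite, mul_one, mul_zero]
  exact Fintype.sum_ite_eq' i _

theorem mem_range_toRational_iff {y : S}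
    {b : Module.Basis (Fin 2) (S.presheaf.stalk y) (FormStalk S y)}
    {E : Module.Basis (Fin 2) S.functionField Ω[S.functionField⁄ℂ]}
    (h : ∀ i, toRational y (b i) = E i) {ω : Ω[S.functionField⁄ℂ]} :
    ω ∈ LinearMap.range (toRational y) ↔ ∀ i, E.repr ω i ∈ regularAt y := by
  constructor
  · rintro ⟨n, rfl⟩ i
    exact ⟨b.repr n i, (repr_toRational h n i).symm⟩
  · intro hω
    choose c hc using hω
    refine ⟨∑ i, c i • b i, ?_⟩
    rw [map_sum, ← E.sum_repr ω]
    refine Finset.sum_congr rfl fun i _ => ?_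
    rw [toRational_smul, h, hc]

variable [SmoothOfRelativeDimension 2 (S ↘ Spec (.of ℂ))]

theorem exists_rational_frame (x : S) : ∃ (W : S.Opens) (_ : x ∈ W)
    (E : Module.Basis (Fin 2) S.functionField Ω[S.functionField⁄ℂ]), ∀ y ∈ W,
      ∃ b : Module.Basis (Fin 2) (S.presheaf.stalk y) (FormStalk S y),
        ∀ i, toRational y (b i) = E i := by
  obtain ⟨W, hxW, e, he⟩ := exists_frame x
  obtain ⟨b, hb⟩ := he x hxW
  have := isLocalizedModule_toRational x
  refine ⟨W, hxW, b.ofIsLocalizedModule S.functionField (nonZeroDivisors _) (toRational x),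
    fun y hy => ?_⟩
  obtain ⟨b', hb'⟩ := he y hy
  refine ⟨b', fun i => ?_⟩
  rw [Module.Basis.ofIsLocalizedModule_apply, hb, hb']
  exact toRational_form_eq (e i).2.1 ⟨y, hy⟩ ⟨x, hxW⟩

theorem toRational_injective (x : S) : Function.Injective (toRational x) := by
  obtain ⟨W, hxW, E, hE⟩ := exists_rational_frame x
  obtain ⟨b, hb⟩ := hE x hxW
  intro ω ω' h
  refine b.ext_elem fun i => stalk_algebraMap_injective x ?_
  rw [← repr_toRational hb, ← repr_toRational hb, h]

/-- An expression $\sum a_i\,dc_i$ of the germ at `x` extends to a neighbourhood. It agrees with the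
other germs there, since all of them have the same image among the rational forms and the stalks
inject. -/
theorem exists_formSection {N : ∀ x : S, Submodule (S.presheaf.stalk x) (FormStalk S x)}
    {U : S.Opens} {ω : Ω[S.functionField⁄ℂ]} (hω : ∀ y ∈ U, ∃ n ∈ N y, toRational y n = ω) :
    ∃ s : formSections N U, ∀ y : U, toRational y.1 (s.1 y) = ω := by
  choose n hn hnω using fun y : U => hω y y.2
  refine ⟨⟨n, fun x hx => ?_, hn⟩, hnω⟩
  have h : n ⟨x, hx⟩ ∈ Submodule.span (S.presheaf.stalk x)
      (Set.range (KaehlerDifferential.D ℂ (S.presheaf.stalk x))) := by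
    rw [KaehlerDifferential.span_range_derivation]; trivial
  obtain ⟨k, a, g, hg⟩ := Submodule.mem_span_set'.1 h
  choose c hc using fun i => (g i).2
  choose Wa hWa a' ha' using fun i => S.presheaf.exists_germ_eq (a i)
  choose Wc hWc c' hc' using fun i => S.presheaf.exists_germ_eq (c i)
  let W : S.Opens := U ⊓ ⟨⋂ i, (Wa i ⊓ Wc i : S.Opens), isOpen_iInter_of_finite fun i => (Wa i ⊓ Wc i).isOpen⟩
  have hWa' : ∀ i, W ≤ Wa i := fun i y hy => (Set.mem_iInter.1 hy.2 i).1
  have hWc' : ∀ i, W ≤ Wc i := fun i y hy => (Set.mem_iInter.1 hy.2 i).2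
  have hxW : x ∈ W := ⟨hx, Set.mem_iInter.2 fun i => ⟨hWa i, hWc i⟩⟩
  refine ⟨W, inf_le_left, hxW, k,
    fun i => S.presheaf.map (homOfLE (hWa' i)).op (a' i),
    fun i => S.presheaf.map (homOfLE (hWc' i)).op (c' i), fun y hy => ?_⟩
  apply toRational_injective y
  refine ((hnω ⟨y, hy.1⟩).trans (hnω ⟨x, hx⟩).symm).trans ?_
  rw [← hg, map_sum, map_sum]
  refine Finset.sum_congr rfl fun i _ => ?_
  rw [← hc, ← ha', ← hc', toRational_smul, toRational_smul, toRational_D, toRational_D,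
    TopCat.Presheaf.germ_res_apply, TopCat.Presheaf.germ_res_apply,
    algebraMap_germ_eq (hWa i) (hWa' i hy), algebraMap_germ_eq (hWc i) (hWc' i hy)]

theorem formSections_ext {N : ∀ x : S, Submodule (S.presheaf.stalk x) (FormStalk S x)}
    {U : S.Opens} {s s' : formSections N U}
    (h : ∀ y : U, toRational y.1 (s.1 y) = toRational y.1 (s'.1 y)) : s = s' :=
  Subtype.ext (funext fun y => toRational_injective y.1 (h y))

end RationalForms

/-! ### Generation at the generic points of prime divisors -/

section Stalks

/-- The image of the second exterior power under a determinant. -/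
theorem span_det_eq_of_span_wedge_eq {R M : Type*} [CommRing R] [AddCommGroup M] [Module R M]
    (e : Module.Basis (Fin 2) R M) (G : Set M) (I : Ideal R)
    (h : Submodule.span R {η : ⋀[R]^2 M | ∃ v ∈ G, ∃ w ∈ G, η = exteriorPower.ιMulti R 2 ![v, w]} =
      I • ⊤) :
    Ideal.span {r | ∃ v ∈ G, ∃ w ∈ G, r = e.det ![v, w]} = I := by
  let L : ⋀[R]^2 M →ₗ[R] R := exteriorPower.alternatingMapLinearEquiv e.det
  have hL : ∀ v, L (exteriorPower.ιMulti R 2 v) = e.det v := fun v =>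
    exteriorPower.alternatingMapLinearEquiv_apply_ιMulti e.det v
  have hsurj : LinearMap.range L = ⊤ := by
    refine LinearMap.range_eq_top.2 fun r => ⟨r • exteriorPower.ιMulti R 2 e, ?_⟩
    rw [map_smul, hL, e.det_self, smul_eq_mul, mul_one]
  have h1 := congr_arg (Submodule.map L) h
  rw [Submodule.map_smul'', Submodule.map_top, hsurj, Submodule.map_span, smul_eq_mul,
    Ideal.mul_top] at h1
  rw [← h1]
  refine congr_arg _ (Set.ext fun r => ?_)
  constructor
  · rintro ⟨v, hv, w, hw, rfl⟩
    exact ⟨_, ⟨v, hv, w, hw, rfl⟩, hL _⟩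
  · rintro ⟨_, ⟨v, hv, w, hw, rfl⟩, rfl⟩
    exact ⟨v, hv, w, hw, hL _⟩

/-- In the expansion of $(ta+r\delta)\wedge(tb+s\delta)$ the only term without a factor $t$ is
$\delta\wedge\delta=0$. -/
theorem det_mem_of_mem_sup {R M : Type*} [CommRing R] [AddCommGroup M] [Module R M]
    (e : Module.Basis (Fin 2) R M) (t : R) (δ : M) {v w : M}
    (hv : v ∈ Ideal.span {t} • (⊤ : Submodule R M) ⊔ Submodule.span R {δ})
    (hw : w ∈ Ideal.span {t} • (⊤ : Submodule R M) ⊔ Submodule.span R {δ}) :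
    e.det ![v, w] ∈ Ideal.span {t} := by
  have key : ∀ z ∈ Ideal.span {t} • (⊤ : Submodule R M) ⊔ Submodule.span R {δ},
      ∃ (a : M) (r : R), z = t • a + r • δ := by
    intro z hz
    obtain ⟨y, hy, _, hr, rfl⟩ := Submodule.mem_sup.1 hz
    obtain ⟨r, rfl⟩ := Submodule.mem_span_singleton.1 hr
    rw [Submodule.ideal_span_singleton_smul] at hy
    obtain ⟨a, -, rfl⟩ := Submodule.mem_smul_pointwise_iff_exists _ _ _ |>.1 hy
    exact ⟨a, r, rfl⟩
  obtain ⟨a, r, rfl⟩ := key v hv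
  obtain ⟨b, s, rfl⟩ := key w hw
  rw [Ideal.mem_span_singleton']
  refine ⟨t * e.det ![a, b] + s * e.det ![a, δ] + r * e.det ![δ, b], ?_⟩
  simp only [Module.Basis.det_apply, Matrix.det_fin_two, Module.Basis.toMatrix_apply, map_add,
    map_smul, Finsupp.add_apply, Finsupp.smul_apply, smul_eq_mul, Matrix.cons_val_zero,
    Matrix.cons_val_one]
  ring

variable {S : Scheme.{0}}

theorem PrimeDivisor.ext_point {C C' : PrimeDivisor S} (h : C.point = C'.point) : C = C' := by
  cases C; cases C'; cases h; rfl

theorem PrimeDivisor.idealAt_self (C : PrimeDivisor S) (h : C.point ⤳ C.point) :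
    C.idealAt h = IsLocalRing.maximalIdeal (S.presheaf.stalk C.point) := by
  ext a
  simp [PrimeDivisor.idealAt]

theorem EffectiveDivisor.mem_idealAt {D : EffectiveDivisor S} {x : S} {a : S.presheaf.stalk x} :
    a ∈ D.idealAt x ↔ ∀ (C : PrimeDivisor S) (h : C.point ⤳ x),
      S.presheaf.stalkSpecializes h a ∈
        IsLocalRing.maximalIdeal (S.presheaf.stalk C.point) ^ D C := by
  simp only [EffectiveDivisor.idealAt, Submodule.mem_iInf, Ideal.mem_comap]

/-- The normal crossings condition is imposed at all points, and at a point of codimension one it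
supplies a single parameter. -/
theorem exists_uniformizer {F : EffectiveDivisor S} (hnc : F.HasSimpleNormalCrossings)
    (C : PrimeDivisor S) : ∃ t : S.presheaf.stalk C.point, t ≠ 0 ∧
      IsLocalRing.maximalIdeal (S.presheaf.stalk C.point) = Ideal.span {t} := by
  obtain ⟨n, t, T, hn, ht, -⟩ := hnc C.point
  rw [C.dim_eq_one] at hn
  obtain rfl : n = 1 := by exact_mod_cast hn.symm
  have h1 : IsLocalRing.maximalIdeal (S.presheaf.stalk C.point) = Ideal.span {t 0} := by
    rw [← ht]
    congr 1
    ext z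
    simp [eq_comm]
  refine ⟨t 0, fun h0 => ?_, h1⟩
  rw [h0, Ideal.span_singleton_eq_bot.2 rfl] at h1
  have h2 := IsLocalRing.maximalIdeal_height_eq_ringKrullDim (R := S.presheaf.stalk C.point)
  rw [h1, Ideal.height_bot, C.dim_eq_one] at h2
  exact absurd h2 (by decide)

variable [IsIntegral S]

theorem PrimeDivisor.eq_of_specializes {C C' : PrimeDivisor S} (h : C'.point ⤳ C.point) :
    C' = C :=
  PrimeDivisor.ext_point (eq_of_specializes_of_dim_eq_one h C'.dim_eq_one C.dim_eq_one)

/-- No prime divisor other than `C` passes through the generic point of `C`. -/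
theorem EffectiveDivisor.idealAt_point (D : EffectiveDivisor S) (C : PrimeDivisor S) :
    D.idealAt C.point = IsLocalRing.maximalIdeal (S.presheaf.stalk C.point) ^ D C := by
  ext a
  rw [EffectiveDivisor.mem_idealAt]
  refine ⟨fun h => by simpa using h C (specializes_refl _), fun ha C' h => ?_⟩
  obtain rfl := PrimeDivisor.eq_of_specializes h
  simpa using ha

variable [S.Over (Spec (.of ℂ))]

/-- The stalk at `x` of `Ω¹_S(log D)(-D)`. -/
abbrev logTwistStalk (D : EffectiveDivisor S) (x : S) :
    Submodule (S.presheaf.stalk x) (FormStalk S x) :=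
  (D.idealAt x • logStalk D x).comap (toRational x)

theorem logTwistStalk_eq_top {D : EffectiveDivisor S} {x : S} (h : D.idealAt x = ⊤) :
    logTwistStalk D x = ⊤ := by
  refine Submodule.eq_top_iff'.2 fun ω => ?_
  rw [Submodule.mem_comap, h, Submodule.top_smul]
  exact Submodule.mem_sup_left ⟨ω, rfl⟩

theorem smul_inv_smul_D {x : S} {f : S.presheaf.stalk x} (hf : f ≠ 0) :
    f • ((algebraMap (S.presheaf.stalk x) S.functionField f)⁻¹ •
      KaehlerDifferential.D ℂ S.functionField (algebraMap (S.presheaf.stalk x) S.functionField f)) =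
      toRational x (KaehlerDifferential.D ℂ _ f) := by
  rw [toRational_D, ← algebraMap_smul S.functionField f, smul_smul, mul_inv_cancel₀, one_smul]
  exact fun h => hf ((map_eq_zero_iff _ (stalk_algebraMap_injective x)).1 h)

variable [SmoothOfRelativeDimension 2 (S ↘ Spec (.of ℂ))]

/-- Every local equation of `C` is $f=ut$, and $f\cdot df/f=df=u\,dt+t\,du$. The right-hand side is
the module that `mem_of_map_residue_eq_zero` attaches to the forms vanishing on `C`. -/
theorem logTwistStalk_point {D : EffectiveDivisor S} {C : PrimeDivisor S} (hC : D C = 1)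
    {t : S.presheaf.stalk C.point}
    (ht : IsLocalRing.maximalIdeal (S.presheaf.stalk C.point) = Ideal.span {t}) (ht0 : t ≠ 0) :
    logTwistStalk D C.point = Ideal.span {t} • (⊤ : Submodule (S.presheaf.stalk C.point) (FormStalk S C.point)) ⊔
      Submodule.span _ {KaehlerDifferential.D ℂ _ t} := by
  set Q := Ideal.span {t} • (⊤ : Submodule (S.presheaf.stalk C.point) (FormStalk S C.point)) ⊔
      Submodule.span _ {KaehlerDifferential.D ℂ _ t} with hQ
  have hD : D.idealAt C.point = Ideal.span {t} := by
    rw [EffectiveDivisor.idealAt_point, hC, pow_one, ht]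
  have htm : t ∈ Ideal.span {t} := Ideal.mem_span_singleton_self t
  apply le_antisymm
  · have hle : D.idealAt C.point • logStalk D C.point ≤ Q.map (toRational C.point) := by
      rw [hD, Submodule.smul_le]
      intro r hr n hn
      obtain ⟨_, ⟨a, rfl⟩, z, hz, rfl⟩ := Submodule.mem_sup.1 hn
      rw [smul_add]
      refine Submodule.add_mem _ ⟨r • a, ?_, map_smul _ _ _⟩ ?_
      · exact Submodule.mem_sup_left (Submodule.smul_mem_smul hr trivial)
      · induction hz using Submodule.span_induction with
        | mem y hy =>
          obtain ⟨C', h, f, hC', hf, rfl⟩ := hy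
          obtain rfl := PrimeDivisor.eq_of_specializes h
          rw [PrimeDivisor.idealAt_self, ht] at hf
          have hf0 : f ≠ 0 := by
            rintro rfl
            exact ht0 (by simpa using hf)
          rw [hf] at hr
          obtain ⟨c, rfl⟩ := Ideal.mem_span_singleton'.1 hr
          rw [mul_smul, smul_inv_smul_D hf0]
          refine ⟨c • KaehlerDifferential.D ℂ _ f, Submodule.smul_mem _ _ ?_, map_smul _ _ _⟩
          have hft : f ∈ Ideal.span {t} := hf ▸ Ideal.mem_span_singleton_self f
          obtain ⟨u, rfl⟩ := Ideal.mem_span_singleton'.1 hft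
          rw [Derivation.leibniz]
          exact Submodule.add_mem _
            (Submodule.mem_sup_right (Submodule.smul_mem _ _ (Submodule.mem_span_singleton_self _)))
            (Submodule.mem_sup_left (Submodule.smul_mem_smul htm trivial))
        | zero => simp
        | add y z _ _ hy hz =>
          rw [smul_add]
          exact Submodule.add_mem _ (hy (Submodule.add_mem _ (Submodule.mem_sup_left ⟨a, rfl⟩)
            (Submodule.mem_sup_right ‹_›))) (hz (Submodule.add_mem _ (Submodule.mem_sup_left ⟨a, rfl⟩)
            (Submodule.mem_sup_right ‹_›)))
        | smul c y _ hy =>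
          rw [smul_comm]
          exact Submodule.smul_mem _ _ (hy (Submodule.add_mem _ (Submodule.mem_sup_left ⟨a, rfl⟩)
            (Submodule.mem_sup_right ‹_›)))
    intro ω hω
    obtain ⟨q, hq, hqω⟩ := hle hω
    rwa [← toRational_injective _ hqω]
  · rw [hQ, sup_le_iff, Submodule.smul_le, Submodule.span_singleton_le_iff_mem]
    refine ⟨fun r hr n _ => ?_, ?_⟩
    · rw [Submodule.mem_comap, map_smul, hD]
      exact Submodule.smul_mem_smul hr (Submodule.mem_sup_left ⟨n, rfl⟩)
    · rw [Submodule.mem_comap, ← smul_inv_smul_D ht0, hD]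
      refine Submodule.smul_mem_smul htm (Submodule.mem_sup_right (Submodule.subset_span ?_))
      exact ⟨C, specializes_refl _, t, by simp [hC], by rw [PrimeDivisor.idealAt_self, ht], rfl⟩

/-- At the generic point of a prime divisor, two forms in `V` generate `Ω¹_S(log F)(-F)`. -/
theorem exists_generators_logTwistStalk {V : Submodule ℂ (GlobalForms S)} {F : EffectiveDivisor S}
    (hF : IsBaseDivisor V F) (hred : F.IsReduced) (hnc : F.HasSimpleNormalCrossings)
    (hcontr : IsContractedBy F V) (C : PrimeDivisor S)
    (e : Module.Basis (Fin 2) (S.presheaf.stalk C.point) (FormStalk S C.point)) :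
    evalStalk V C.point ≤ logTwistStalk F C.point ∧ ∃ v ∈ V, ∃ w ∈ V,
      e.det ![GlobalForms.germ C.point v, GlobalForms.germ C.point w] ≠ 0 ∧
      logTwistStalk F C.point ≤
        Submodule.span _ {GlobalForms.germ C.point v, GlobalForms.germ C.point w} := by
  obtain ⟨t, ht0, ht⟩ := exists_uniformizer hnc C
  have hdet := span_det_eq_of_span_wedge_eq e (GlobalForms.germ C.point '' V) _ (by
    rw [← hF C]
    refine congr_arg _ (Set.ext fun η => ?_)
    simp)
  -- Reducedness leaves two cases: off `F` take $d=1$ and all of $\Omega^1$; on `F` take $d=t$ and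
  -- $t\Omega^1+R\,dt$, which contains `V` by contraction.
  obtain ⟨d, hd, hdF, hsub, hQ⟩ : ∃ d ≠ 0, IsLocalRing.maximalIdeal (S.presheaf.stalk C.point) ^ F C =
      Ideal.span {d} ∧ GlobalForms.germ C.point '' V ⊆ logTwistStalk F C.point ∧
      ∀ v ∈ logTwistStalk F C.point, ∀ w ∈ logTwistStalk F C.point,
        e.det ![v, w] ∈ Ideal.span {d} := by
    have hC := hred C
    obtain hC | hC : F C = 0 ∨ F C = 1 := by omega
    · rw [logTwistStalk_eq_top (by rw [EffectiveDivisor.idealAt_point, hC, pow_zero, Ideal.one_eq_top]), hC]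
      refine ⟨1, one_ne_zero, ?_, fun _ _ => trivial, fun _ _ _ _ => ?_⟩
      · rw [pow_zero, Ideal.span_singleton_one, Ideal.one_eq_top]
      · rw [Ideal.span_singleton_one]; trivial
    · rw [logTwistStalk_point hC ht ht0, hC]
      refine ⟨t, ht0, by rw [pow_one, ht], ?_, fun v hv w hw => det_mem_of_mem_sup e t _ hv hw⟩
      rintro _ ⟨v, hv, rfl⟩
      exact mem_of_map_residue_eq_zero ℂ ht (hcontr C (by simp [hC]) v hv)
  obtain ⟨_, ⟨v, hv, rfl⟩, _, ⟨w, hw, rfl⟩, h⟩ :=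
    exists_le_span_pair_of_det e hsub hd (hdet.trans hdF) hQ
  exact ⟨Submodule.span_le.2 hsub, v, hv, w, hw, h⟩

end Stalks

/-! ### The logarithmic sheaf at arbitrary points -/

section SurfacePoints

variable {S : Scheme.{0}}

/-- A component of a divisor `D` locally defined by `f` corresponds to each regular parameter
dividing `f`. -/
theorem exists_component_of_dvd [IsIntegral S] {D : EffectiveDivisor S} (hred : D.IsReduced)
    {x : S} {f s : S.presheaf.stalk x} (hD : D.idealAt x = Ideal.span {f}) (hsf : s ∣ f)
    (hs : (Ideal.span {s}).IsPrime) (hs1 : (Ideal.span {s}).height = 1) :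
    ∃ (C : PrimeDivisor S) (h : C.point ⤳ x), D C ≠ 0 ∧ C.idealAt h = Ideal.span {s} := by
  classical
  obtain ⟨p, h, hp⟩ := exists_generizationIdeal_eq x _ hs
  let C : PrimeDivisor S := ⟨p, by rw [ringKrullDim_stalk_eq_height h, hp, hs1]; rfl⟩
  refine ⟨C, h, fun hC => ?_, hp⟩
  -- If `C` were not in `D`, each component of `D` through `x` would have a height-one prime
  -- different from $(s)$, hence an element `g` of it outside $(s)$; for other divisors $g=1$. The
  -- product over the support vanishes along `D`, so it lies in $(f)\subseteq(s)$, against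
  -- primality.
  have hex : ∀ C' : PrimeDivisor S, ∃ g : S.presheaf.stalk x,
      (∀ h' : C'.point ⤳ x, D C' ≠ 0 → g ∈ C'.idealAt h') ∧ g ∉ Ideal.span {s} := by
    intro C'
    by_cases hC' : C'.point ⤳ x ∧ D C' ≠ 0
    · obtain ⟨h', hDC'⟩ := hC'
      have hle : ¬ generizationIdeal h' ≤ Ideal.span {s} := fun hle => by
        have e1 : (generizationIdeal h').height = 1 := by
          have := ringKrullDim_stalk_eq_height h'
          rw [C'.dim_eq_one] at this
          exact (WithBot.coe_injective this).symm
        have : (Ideal.span {s}).FiniteHeight := ⟨Or.inr (by rw [hs1]; decide)⟩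
        have : (generizationIdeal h').FiniteHeight := ⟨Or.inr (by rw [e1]; decide)⟩
        have e2 := Ideal.eq_of_le_of_height_le _ hle (by rw [hs1, e1])
        have e3 : C' = C :=
          PrimeDivisor.ext_point (eq_of_generizationIdeal_eq h' h (e2.trans hp.symm))
        exact hDC' (e3 ▸ hC)
      obtain ⟨g, hg, hgs⟩ := Set.not_subset.1 hle
      exact ⟨g, fun _ _ => hg, hgs⟩
    · refine ⟨1, fun h' hD' => absurd ⟨h', hD'⟩ hC', fun h1 => ?_⟩
      exact hs.ne_top ((Ideal.eq_top_iff_one _).2 h1)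
  choose g hg hgs using hex
  have hprod : ∏ C' ∈ D.support, g C' ∈ D.idealAt x := by
    rw [EffectiveDivisor.mem_idealAt]
    intro C' h'
    by_cases hD' : D C' = 0
    · rw [hD', pow_zero, Ideal.one_eq_top]; trivial
    · have : D C' = 1 := le_antisymm (hred C') (Nat.one_le_iff_ne_zero.2 hD')
      rw [this, pow_one]
      have h1 : g C' ∈ C'.idealAt h' := hg C' h' hD'
      exact (Ideal.mul_mem_right _ (C'.idealAt h') h1 |> fun h2 =>
        (Finset.mul_prod_erase D.support g (Finsupp.mem_support_iff.2 hD')) ▸ h2)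
  rw [hD] at hprod
  have h2 : ∏ C' ∈ D.support, g C' ∈ Ideal.span {s} :=
    (Ideal.span_singleton_le_span_singleton.2 hsf) hprod
  obtain ⟨C', -, hC'⟩ := (Ideal.IsPrime.prod_mem_iff (hp := hs)).1 h2
  exact hgs C' hC'

/-- A basis of the differentials at `x` remains one at the generizations of `x`. -/
theorem exists_basis_of_specializes [S.Over (Spec (.of ℂ))] [IsIntegral S] {p x : S} (h : p ⤳ x)
    (b : Module.Basis (Fin 2) (S.presheaf.stalk x) (FormStalk S x)) :
    ∃ b' : Module.Basis (Fin 2) (S.presheaf.stalk p) (FormStalk S p),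
      ∀ i, toRational p (b' i) = toRational x (b i) := by
  let := (S.presheaf.stalkSpecializes h).hom.toAlgebra
  have := isLocalization_stalkSpecializes h
  have htower : IsScalarTower ℂ (S.presheaf.stalk x) (S.presheaf.stalk p) :=
    .of_algebraMap_eq fun c => (S.presheaf.germ_stalkSpecializes_apply (U := ⊤) trivial h _).symm
  refine ⟨b.ofIsLocalizedModule (S.presheaf.stalk p) (generizationIdeal h).primeCompl
    (KaehlerDifferential.map ℂ ℂ (S.presheaf.stalk x) (S.presheaf.stalk p)), fun i => ?_⟩
  rw [Module.Basis.ofIsLocalizedModule_apply]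
  generalize b i = ω
  have hω : ω ∈ Submodule.span (S.presheaf.stalk x)
      (Set.range (KaehlerDifferential.D ℂ (S.presheaf.stalk x))) := by
    rw [KaehlerDifferential.span_range_derivation]; trivial
  induction hω using Submodule.span_induction with
  | mem y hy =>
    obtain ⟨a, rfl⟩ := hy
    rw [KaehlerDifferential.map_D, toRational_D, toRational_D]
    exact congr_arg _ (algebraMap_stalkSpecializes h a)
  | zero => simp
  | add y z _ _ hy hz => rw [map_add, map_add, hy, hz, map_add]
  | smul a y _ hy =>
    rw [map_smul, toRational_smul, ← hy, ← algebraMap_smul (S.presheaf.stalk p) a, toRational_smul]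
    congr 1
    exact algebraMap_stalkSpecializes h a

variable [S.Over (Spec (.of ℂ))] [SmoothOfRelativeDimension 2 (S ↘ Spec (.of ℂ))]

/-- The parameters come with the normal crossings condition, away from `F` as well; their number is
at most two because their differentials are independent in a fibre of rank two. -/
theorem hasRegularStalks_of_normalCrossings {F : EffectiveDivisor S}
    (hnc : F.HasSimpleNormalCrossings) : HasRegularStalks S := by
  intro x
  obtain ⟨n, t, T, hn, ht, -⟩ := hnc x
  obtain ⟨e⟩ := exists_stalk_basis x
  have := isLocallyNoetherian_of_smooth S
  have := residueField_formallySmooth x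
  exact ⟨n, t, by simpa using dim_le_card_of_basis ℂ e ht hn, hn, ht⟩

variable [IsIntegral S]

/-- The coefficients of a form in `Ω¹_S(log D)(-D)` along a component of `D`. -/
theorem repr_mem_of_mem_logTwistStalk {D : EffectiveDivisor S} (hred : D.IsReduced)
    {C : PrimeDivisor S} {x : S} (h : C.point ⤳ x) (hC : D C ≠ 0) {s : S.presheaf.stalk x}
    (hs : C.idealAt h = Ideal.span {s}) (hs0 : s ≠ 0)
    (b : Module.Basis (Fin 2) (S.presheaf.stalk x) (FormStalk S x)) {i j : Fin 2} (hij : j ≠ i)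
    (hb : b i = KaehlerDifferential.D ℂ _ s) {ω : FormStalk S x} {n : FormStalk S C.point}
    (hn : n ∈ logTwistStalk D C.point) (hnω : toRational C.point n = toRational x ω) :
    b.repr ω j ∈ Ideal.span {s} := by
  obtain ⟨b', hb'⟩ := exists_basis_of_specializes h b
  set t := S.presheaf.stalkSpecializes h s with ht
  have hm : IsLocalRing.maximalIdeal (S.presheaf.stalk C.point) = Ideal.span {t} := by
    let := (S.presheaf.stalkSpecializes h).hom.toAlgebra
    have := isLocalization_stalkSpecializes h
    rw [← IsLocalization.AtPrime.map_eq_maximalIdeal (generizationIdeal h)]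
    change (C.idealAt h).map _ = _
    rw [hs, Ideal.map_span, Set.image_singleton]
    rfl
  have ht0 : t ≠ 0 := fun h0 => hs0 (stalk_algebraMap_injective x (by
    rw [← algebraMap_stalkSpecializes h, ← ht, h0, map_zero, map_zero]))
  have hC1 : D C = 1 := le_antisymm (hred C) (Nat.one_le_iff_ne_zero.2 hC)
  rw [logTwistStalk_point hC1 hm ht0] at hn
  have hb'i : b' i = KaehlerDifferential.D ℂ _ t := by
    apply toRational_injective
    rw [hb', hb, toRational_D, toRational_D, algebraMap_stalkSpecializes]
  have hcoef : b'.repr n j = S.presheaf.stalkSpecializes h (b.repr ω j) := by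
    apply stalk_algebraMap_injective
    have := isLocalizedModule_toRational x
    let E := b.ofIsLocalizedModule S.functionField (nonZeroDivisors _) (toRational x)
    have hE : ∀ i, toRational x (b i) = E i := fun i =>
      (Module.Basis.ofIsLocalizedModule_apply _ _ _ _ _).symm
    rw [algebraMap_stalkSpecializes, ← repr_toRational hE, ← hnω,
      repr_toRational (fun i => (hb' i).trans (hE i))]
  -- In $t\Omega^1+R\,dt$ the second summand contributes only to the coordinate `i`, as $b'_i=dt$.
  have hmem : b'.repr n j ∈ Ideal.span {t} := by
    obtain ⟨y, hy, _, hr, rfl⟩ := Submodule.mem_sup.1 hn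
    obtain ⟨r, rfl⟩ := Submodule.mem_span_singleton.1 hr
    rw [Submodule.ideal_span_singleton_smul] at hy
    obtain ⟨a, -, rfl⟩ := Submodule.mem_smul_pointwise_iff_exists _ _ _ |>.1 hy
    rw [← hb'i]
    simp only [map_add, map_smul, Finsupp.add_apply, Finsupp.smul_apply, Module.Basis.repr_self,
      smul_eq_mul, Finsupp.single_apply, if_neg hij.symm, mul_zero, add_zero]
    exact Ideal.mul_mem_right _ _ (Ideal.mem_span_singleton_self t)
  rw [← hs]
  change S.presheaf.stalkSpecializes h _ ∈ IsLocalRing.maximalIdeal (S.presheaf.stalk C.point)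
  rw [← hcoef, hm]
  exact hmem

/-- The sheaf `Ω¹_S(log D)(-D)` is determined in codimension one. -/
theorem mem_logTwistStalk_of_forall {D : EffectiveDivisor S} (hred : D.IsReduced)
    (hnc : D.HasSimpleNormalCrossings) {x : S} {ω : FormStalk S x}
    (hω : ∀ C : PrimeDivisor S, C.point ⤳ x →
      ∃ n ∈ logTwistStalk D C.point, toRational C.point n = toRational x ω) :
    ω ∈ logTwistStalk D x := by
  obtain ⟨n, t, T, hn, ht, hD⟩ := hnc x
  obtain ⟨e⟩ := exists_stalk_basis x
  have := isLocallyNoetherian_of_smooth S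
  have := residueField_formallySmooth x
  have hn2 : n ≤ 2 := by simpa using dim_le_card_of_basis ℂ e ht hn
  -- In dimension zero the divisor is trivial at `x`; in dimension one `x` is itself the generic
  -- point of a prime divisor. Only dimension two needs an argument.
  obtain rfl | rfl | rfl : n = 0 ∨ n = 1 ∨ n = 2 := by omega
  · have hT : T = ∅ := Subsingleton.elim _ _
    rw [hT, Finset.prod_empty, Ideal.span_singleton_one] at hD
    rw [logTwistStalk_eq_top hD]
    trivial
  · obtain ⟨m, hm, hmω⟩ := hω ⟨x, hn⟩ (specializes_refl x)
    rwa [← toRational_injective x hmω]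
  · obtain ⟨hli, hsp⟩ := (Module.Basis.is_basis_iff_det e).2 (isUnit_det_D_parameters ℂ e ht hn)
    let b := Module.Basis.mk hli hsp.ge
    have hb : ∀ i, b i = KaehlerDifferential.D ℂ _ (t i) := fun i =>
      Module.Basis.mk_apply hli hsp.ge i
    have hst : ∀ i j, j ≠ i → Ideal.span {t i, t j} =
        IsLocalRing.maximalIdeal (S.presheaf.stalk x) := by
      intro i j hij
      rw [← ht]
      congr 1
      ext z
      fin_cases i <;> fin_cases j <;> simp [Fin.exists_fin_two, eq_comm, or_comm] at hij ⊢
    have hprime : ∀ i, (Ideal.span {t i}).IsPrime ∧ (Ideal.span {t i}).height = 1 := fun i =>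
      prime_of_regular_parameter (hst i (1 - i) (by fin_cases i <;> simp)) hn
    have ht0 : ∀ i, t i ≠ 0 := fun i h0 => by
      have := (hprime i).2
      rw [h0, Ideal.span_singleton_eq_bot.2 rfl, Ideal.height_bot] at this
      exact absurd this (by decide)
    -- `g i` is the factor of the equation of `D` coming from $t_i$. Along that branch the
    -- coefficient of the other differential is divisible by `g i`, while $dt_i=g_i\eta_i$ with
    -- $\eta_i$ logarithmic. Hence $\omega=g_0g_1(d_0\eta_0+d_1\eta_1)$.
    let g : Fin 2 → S.presheaf.stalk x := fun i => if i ∈ T then t i else 1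
    have hcomp : ∀ i ∈ T, ∃ (C : PrimeDivisor S) (h : C.point ⤳ x), D C ≠ 0 ∧
        C.idealAt h = Ideal.span {t i} := fun i hi =>
      exists_component_of_dvd hred hD (Finset.dvd_prod_of_mem t hi) (hprime i).1 (hprime i).2
    have hcoef : ∀ i j, j ≠ i → ∃ d, b.repr ω j = d * g i := by
      intro i j hij
      by_cases hi : i ∈ T
      · obtain ⟨C, h, hC, hCt⟩ := hcomp i hi
        obtain ⟨m, hm, hmω⟩ := hω C h
        obtain ⟨d, hd⟩ := Ideal.mem_span_singleton'.1
          (repr_mem_of_mem_logTwistStalk hred h hC hCt (ht0 i) b hij (hb i) hm hmω)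
        exact ⟨d, by simp only [g, if_pos hi, hd]⟩
      · exact ⟨b.repr ω j, by simp only [g, if_neg hi, mul_one]⟩
    have hlog : ∀ i, ∃ η ∈ logStalk D x, toRational x (b i) = g i • η := by
      intro i
      by_cases hi : i ∈ T
      · obtain ⟨C, h, hC, hCt⟩ := hcomp i hi
        refine ⟨_, Submodule.mem_sup_right (Submodule.subset_span ⟨C, h, t i, hC, hCt, rfl⟩), ?_⟩
        simp only [g, if_pos hi]
        rw [smul_inv_smul_D (ht0 i), hb]
      · refine ⟨_, Submodule.mem_sup_left ⟨b i, rfl⟩, ?_⟩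
        simp only [g, if_neg hi, one_smul]
    have hprod : ∏ i ∈ T, t i = g 0 * g 1 := by
      rw [← Fin.prod_univ_two g]
      simp [g, Finset.prod_ite_mem]
    obtain ⟨d₀, hd₀⟩ := hcoef 1 0 (by decide)
    obtain ⟨d₁, hd₁⟩ := hcoef 0 1 (by decide)
    obtain ⟨η₀, hη₀, h₀⟩ := hlog 0
    obtain ⟨η₁, hη₁, h₁⟩ := hlog 1
    rw [Submodule.mem_comap, hD, hprod, ← b.sum_repr ω, Fin.sum_univ_two, hd₀, hd₁, map_add,
      map_smul, map_smul, h₀, h₁, smul_smul, smul_smul]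
    refine Submodule.add_mem _ (Submodule.smul_mem_smul ?_ hη₀) (Submodule.smul_mem_smul ?_ hη₁)
    · exact Ideal.mem_span_singleton'.2 ⟨d₀, by ring⟩
    · exact Ideal.mem_span_singleton'.2 ⟨d₁, by ring⟩

end SurfacePoints

/-! ### Functionals on rational forms that are regular on `V` -/

section RationalDuals

variable {S : Scheme.{0}} [S.Over (Spec (.of ℂ))] [IsIntegral S]

/-- The linear functionals on rational forms that are regular on the forms in `V` along `W`. -/
def IsRegularFunctional (V : Submodule ℂ (GlobalForms S)) (W : S.Opens)
    (l : Ω[S.functionField⁄ℂ] →ₗ[S.functionField] S.functionField) : Prop :=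
  ∀ v ∈ V, ∀ y ∈ W, l v.rational ∈ regularAt y

theorem IsRegularFunctional.apply_mem {V : Submodule ℂ (GlobalForms S)} {x : S}
    {l : Ω[S.functionField⁄ℂ] →ₗ[S.functionField] S.functionField}
    (hl : ∀ v ∈ V, l v.rational ∈ regularAt x) {n : FormStalk S x} (hn : n ∈ evalStalk V x) :
    l (toRational x n) ∈ regularAt x := by
  induction hn using Submodule.span_induction with
  | mem y hy =>
    obtain ⟨v, hv, rfl⟩ := hy
    rw [toRational_globalForm]
    exact hl v hv
  | zero => rw [map_zero, map_zero]; exact zero_mem _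
  | add y z _ _ hy hz => rw [map_add, map_add]; exact add_mem hy hz
  | smul a y _ hy =>
    rw [toRational_smul, map_smul, smul_eq_mul]
    exact mul_mem ⟨a, rfl⟩ hy

/-- The coordinates of a frame of $\Omega^1$ serve as test functionals: they are regular on every
regular form, in particular on `V`, and together they detect a form. -/
theorem isRegularFunctional_coord {V : Submodule ℂ (GlobalForms S)} {W : S.Opens}
    {E : Module.Basis (Fin 2) S.functionField Ω[S.functionField⁄ℂ]}
    (hE : ∀ y ∈ W, ∃ b : Module.Basis (Fin 2) (S.presheaf.stalk y) (FormStalk S y),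
        ∀ i, toRational y (b i) = E i) (i : Fin 2) : IsRegularFunctional V W (E.coord i) := by
  intro v _ y hy
  obtain ⟨b, hb⟩ := hE y hy
  exact (mem_range_toRational_iff hb).1 ⟨v.germ y, toRational_globalForm y v⟩ i

variable [SmoothOfRelativeDimension 2 (S ↘ Spec (.of ℂ))]

theorem span_rational_eq_top {V : Submodule ℂ (GlobalForms S)}
    (hV : evalStalk V (genericPoint S) = ⊤) :
    Submodule.span S.functionField (GlobalForms.rational '' (V : Set (GlobalForms S))) = ⊤ := by
  obtain ⟨W, hW, E, hE⟩ := exists_rational_frame (genericPoint S)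
  obtain ⟨b, hb⟩ := hE _ hW
  rw [eq_top_iff, ← E.span_eq, Submodule.span_le]
  rintro _ ⟨i, rfl⟩
  rw [← hb]
  have h : b i ∈ evalStalk V (genericPoint S) := hV ▸ trivial
  generalize b i = n at h
  induction h using Submodule.span_induction with
  | mem y hy =>
    obtain ⟨v, hv, rfl⟩ := hy
    exact Submodule.subset_span ⟨v, hv, rfl⟩
  | zero => rw [map_zero]; exact zero_mem _
  | add y z _ _ hy hz => rw [map_add]; exact add_mem hy hz
  | smul a y _ hy =>
    rw [toRational_smul]
    exact Submodule.smul_mem _ _ hy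

/-- `V` generates `Ω¹_S(log F)(-F)` in codimension one. -/
def GeneratesInCodimOne (V : Submodule ℂ (GlobalForms S)) (F : EffectiveDivisor S) : Prop :=
  ∀ (C : PrimeDivisor S) (e : Module.Basis (Fin 2) (S.presheaf.stalk C.point)
      (FormStalk S C.point)),
    evalStalk V C.point ≤ logTwistStalk F C.point ∧ ∃ v ∈ V, ∃ w ∈ V,
      e.det ![GlobalForms.germ C.point v, GlobalForms.germ C.point w] ≠ 0 ∧
      logTwistStalk F C.point ≤
        Submodule.span _ {GlobalForms.germ C.point v, GlobalForms.germ C.point w}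

theorem GeneratesInCodimOne.evalStalk_eq {V : Submodule ℂ (GlobalForms S)}
    {F : EffectiveDivisor S} (h : GeneratesInCodimOne V F) (C : PrimeDivisor S) :
    evalStalk V C.point = logTwistStalk F C.point := by
  obtain ⟨e⟩ := exists_stalk_basis C.point
  obtain ⟨hle, v, hv, w, hw, -, hle'⟩ := h C e
  refine le_antisymm hle (hle'.trans (Submodule.span_mono ?_))
  rintro _ (rfl | rfl)
  exacts [⟨v, hv, rfl⟩, ⟨w, hw, rfl⟩]

/-- At the prime divisors the logarithmic stalk is spanned by `V`, where `l` is regular by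
hypothesis; Hartogs does the rest. -/
theorem mem_regularAt_of_mem_logTwistStalk {V : Submodule ℂ (GlobalForms S)}
    {F : EffectiveDivisor S} (hVF : GeneratesInCodimOne V F) (hS : HasRegularStalks S)
    {W : S.Opens} {l : Ω[S.functionField⁄ℂ] →ₗ[S.functionField] S.functionField}
    (hl : IsRegularFunctional V W l) {ω : Ω[S.functionField⁄ℂ]}
    (hω : ∀ y ∈ W, ∃ n ∈ logTwistStalk F y, toRational y n = ω) {y : S} (hy : y ∈ W) :
    l ω ∈ regularAt y := by
  have := isLocallyNoetherian_of_smooth S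
  refine mem_regularAt_of_forall_primeDivisor hS fun p hpy hp => ?_
  have hpW : p ∈ W := hpy.mem_open W.isOpen hy
  obtain ⟨n, hn, rfl⟩ := hω p hpW
  rw [← hVF.evalStalk_eq ⟨p, hp⟩] at hn
  exact IsRegularFunctional.apply_mem (fun v hv => hl v hv p hpW) hn

/-- A rational form on which all the functionals regular on `V` are regular belongs to the
forms generated by `V` in codimension one. -/
theorem exists_mem_evalStalk_of_forall {V : Submodule ℂ (GlobalForms S)}
    {F : EffectiveDivisor S} (hVF : GeneratesInCodimOne V F) (hS : HasRegularStalks S)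
    {U : S.Opens} {ω : Ω[S.functionField⁄ℂ]}
    (hω : ∀ W ≤ U, ∀ l, IsRegularFunctional V W l → ∀ y ∈ W, l ω ∈ regularAt y)
    {C : PrimeDivisor S} (hC : C.point ∈ U) :
    ∃ n ∈ evalStalk V C.point, toRational C.point n = ω := by
  have := isLocallyNoetherian_of_smooth S
  obtain ⟨W₀, hW₀, E, hE⟩ := exists_rational_frame C.point
  obtain ⟨b, hb⟩ := hE _ hW₀
  obtain ⟨-, v, hv, w, hw, hdet, hle⟩ := hVF C b
  have hdet' : IsUnit (E.det ![v.rational, w.rational]) := by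
    rw [isUnit_iff_ne_zero]
    have h1 : E.det ![v.rational, w.rational] = algebraMap _ S.functionField
        (b.det ![v.germ C.point, w.germ C.point]) := by
      simp only [Module.Basis.det_apply, Matrix.det_fin_two, Module.Basis.toMatrix_apply,
        Matrix.cons_val_zero, Matrix.cons_val_one, ← toRational_globalForm C.point,
        repr_toRational hb, map_sub, map_mul]
    rw [h1]
    exact fun h0 => hdet ((map_eq_zero_iff _ (stalk_algebraMap_injective _)).1 h0)
  obtain ⟨hli, hsp⟩ := (Module.Basis.is_basis_iff_det E).2 hdet'
  let B := Module.Basis.mk hli hsp.ge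
  have hB0 : B 0 = v.rational := Module.Basis.mk_apply hli hsp.ge 0
  have hB1 : B 1 = w.rational := Module.Basis.mk_apply hli hsp.ge 1
  -- The change of basis from the frame `E` to the pair from `V` may have poles along other
  -- divisors; they are removed by shrinking around the generic point of `C`.
  choose O hO hOr using fun ij : Fin 2 × Fin 2 =>
    exists_open_forall_mem_regularAt (B.coord ij.1 (E ij.2)) C.dim_eq_one
  let W : S.Opens := (U ⊓ W₀) ⊓ ⟨⋂ ij, (O ij : Set S), isOpen_iInter_of_finite fun ij => (O ij).isOpen⟩
  have hCW : C.point ∈ W := ⟨⟨hC, hW₀⟩, Set.mem_iInter.2 hO⟩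
  -- The dual basis of `v`, `w` is regular on `V` at `C` because the two germs generate the
  -- evaluation stalk there, and at the other divisors of `W` because the change of basis is
  -- regular. Hartogs covers the remaining points.
  have hreg : ∀ i, IsRegularFunctional V W (B.coord i) := by
    intro i u hu y hy
    refine mem_regularAt_of_forall_primeDivisor hS fun q hqy hq => ?_
    have hqW : q ∈ W := hqy.mem_open W.isOpen hy
    by_cases hqC : q = C.point
    · subst hqC
      have h1 : u.germ C.point ∈ Submodule.span _ {v.germ C.point, w.germ C.point} :=
        hle (hVF.evalStalk_eq C ▸ Submodule.subset_span ⟨u, hu, rfl⟩)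
      obtain ⟨r, s, hrs⟩ := Submodule.mem_span_pair.1 h1
      rw [← toRational_globalForm C.point, ← hrs, map_add, toRational_smul, toRational_smul,
        toRational_globalForm, toRational_globalForm, ← hB0, ← hB1, map_add, map_smul, map_smul,
        Module.Basis.coord_apply, Module.Basis.coord_apply, Module.Basis.repr_self,
        Module.Basis.repr_self, smul_eq_mul, smul_eq_mul]
      refine add_mem (mul_mem ⟨r, rfl⟩ ?_) (mul_mem ⟨s, rfl⟩ ?_) <;>
      · rw [Finsupp.single_apply]
        split_ifs
        exacts [one_mem _, zero_mem _]
    · rw [← E.sum_repr u.rational, map_sum]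
      refine sum_mem fun j _ => ?_
      rw [map_smul, smul_eq_mul]
      exact mul_mem (isRegularFunctional_coord hE j u hu q hqW.1.2)
        (hOr (i, j) q (Set.mem_iInter.1 hqW.2 (i, j)) hq hqC)
  have hmem := fun i => hω W (inf_le_left.trans inf_le_left) _ (hreg i) _ hCW
  obtain ⟨r, hr⟩ := hmem 0
  obtain ⟨s, hs⟩ := hmem 1
  refine ⟨r • v.germ C.point + s • w.germ C.point, Submodule.add_mem _
    (Submodule.smul_mem _ _ (Submodule.subset_span ⟨v, hv, rfl⟩))
    (Submodule.smul_mem _ _ (Submodule.subset_span ⟨w, hw, rfl⟩)), ?_⟩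
  rw [map_add, toRational_smul, toRational_smul, toRational_globalForm, toRational_globalForm,
    hr, hs, ← hB0, ← hB1, ← B.sum_repr ω, Fin.sum_univ_two]
  simp

/-- A rational form on which all the functionals regular on `V` are regular is a section of
`Ω¹_S(log F)(-F)`. -/
theorem exists_mem_logTwistStalk_of_forall {V : Submodule ℂ (GlobalForms S)}
    {F : EffectiveDivisor S} (hVF : GeneratesInCodimOne V F) (hred : F.IsReduced)
    (hnc : F.HasSimpleNormalCrossings) {U : S.Opens} {ω : Ω[S.functionField⁄ℂ]}
    (hω : ∀ W ≤ U, ∀ l, IsRegularFunctional V W l → ∀ y ∈ W, l ω ∈ regularAt y)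
    {x : S} (hx : x ∈ U) : ∃ n ∈ logTwistStalk F x, toRational x n = ω := by
  obtain ⟨W₀, hW₀, E, hE⟩ := exists_rational_frame x
  obtain ⟨b, hb⟩ := hE _ hW₀
  have h : ω ∈ LinearMap.range (toRational x) := by
    rw [mem_range_toRational_iff hb]
    intro i
    exact hω (U ⊓ W₀) inf_le_left _
      (isRegularFunctional_coord (W := U ⊓ W₀) (fun y hy => hE y hy.2) i) x ⟨hx, hW₀⟩
  obtain ⟨n, rfl⟩ := h
  refine ⟨n, mem_logTwistStalk_of_forall hred hnc fun C hCx => ?_, rfl⟩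
  rw [← hVF.evalStalk_eq C]
  exact exists_mem_evalStalk_of_forall hVF (hasRegularStalks_of_normalCrossings hnc) hω
    (hCx.mem_open U.isOpen hx)

end RationalDuals

/-! ### Building morphisms of sheaves of modules -/

section SheafMorphisms

variable {X : Scheme.{0}} {M N : X.Modules}

/-- A morphism of sheaves of modules, from compatible linear maps on sections. -/
def homOfSections (f : ∀ U : X.Opens, Γ(M, U) →ₗ[Γ(X, U)] Γ(N, U))
    (hf : ∀ (U W : X.Opens) (h : W ≤ U) (m : Γ(M, U)),
      f W (M.presheaf.map (homOfLE h).op m) = N.presheaf.map (homOfLE h).op (f U m)) : M ⟶ N :=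
  SheafOfModules.Hom.mk (PresheafOfModules.homMk (M₁ := M.val) (M₂ := N.val)
    { app := fun U => AddCommGrpCat.ofHom (f U.unop).toAddMonoidHom
      naturality := fun U W i => by
        ext m
        exact hf U.unop W.unop i.unop.le m }
    fun U r m => (f U.unop).map_smul r m)

theorem isIso_homOfSections (f : ∀ U : X.Opens, Γ(M, U) →ₗ[Γ(X, U)] Γ(N, U))
    (hf : ∀ (U W : X.Opens) (h : W ≤ U) (m : Γ(M, U)),
      f W (M.presheaf.map (homOfLE h).op m) = N.presheaf.map (homOfLE h).op (f U m))
    (hbij : ∀ U, Function.Bijective (f U)) : IsIso (homOfSections f hf) := by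
  rw [Scheme.Modules.Hom.isIso_iff_isIso_app]
  intro U
  rw [ConcreteCategory.isIso_iff_bijective]
  exact hbij U

/-- A section of the dual of `M`, as a morphism `M|_U ⟶ 𝒪_U`. -/
def toDual {U : X.Opens} (φ : Γ(dual M, U)) : DualSection M U := φ

end SheafMorphisms

/-! ### Values of sections as rational functions -/

section functionValue

variable {S : Scheme.{0}} [IsIntegral S] {U W : S.Opens}

/-- The value at `y` of a regular function, as a rational function. -/
def functionValue (f : Γ(S, U)) {y : S} (hy : y ∈ U) : S.functionField :=
  algebraMap (S.presheaf.stalk y) S.functionField (S.presheaf.germ U y hy f)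

theorem functionValue_map (h : W ≤ U) (f : Γ(S, U)) {y : S} (hy : y ∈ W) :
    functionValue (S.presheaf.map (homOfLE h).op f) hy = functionValue f (h hy) := by
  rw [functionValue, TopCat.Presheaf.germ_res_apply, functionValue]

theorem functionValue_eq (f : Γ(S, U)) {x y : S} (hx : x ∈ U) (hy : y ∈ U) :
    functionValue f hx = functionValue f hy :=
  algebraMap_germ_eq hx hy f

theorem functionValue_add (f g : Γ(S, U)) {y : S} (hy : y ∈ U) :
    functionValue (f + g) hy = functionValue f hy + functionValue g hy := by
  simp only [functionValue, map_add]

theorem functionValue_mul (f g : Γ(S, U)) {y : S} (hy : y ∈ U) :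
    functionValue (f * g) hy = functionValue f hy * functionValue g hy := by
  simp only [functionValue, map_mul]

theorem functionValue_ext {f g : Γ(S, U)}
    (h : ∀ (y : S) (hy : y ∈ U), functionValue f hy = functionValue g hy) : f = g :=
  section_ext h

theorem functionValue_mem_regularAt (f : Γ(S, U)) {y : S} (hy : y ∈ U) :
    functionValue f hy ∈ regularAt y :=
  ⟨_, rfl⟩

theorem exists_functionValue_eq {g : S.functionField} (hg : ∀ y ∈ U, g ∈ regularAt y) :
    ∃ f : Γ(S, U), ∀ (y : S) (hy : y ∈ U), functionValue f hy = g :=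
  exists_section_of_forall_mem_regularAt hg

theorem genericPoint_mem {x : S} (hx : x ∈ U) : genericPoint S ∈ U :=
  ((genericPoint_spec S).mem_open_set_iff U.isOpen).2 ⟨x, trivial, hx⟩

/-- Two rational functions are regular on a common neighbourhood of the generic point. -/
theorem exists_open_sections (c : Fin 2 → S.functionField) {W : S.Opens} {x : S} (hx : x ∈ W) :
    ∃ (W' : S.Opens) (_ : W' ≤ W) (_ : genericPoint S ∈ W') (f : Fin 2 → Γ(S, W')),
      ∀ (i : Fin 2) (y : S) (hy : y ∈ W'), functionValue (f i) hy = c i := by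
  have hη : genericPoint S ∈ W := genericPoint_mem hx
  -- The local ring at the generic point is the function field itself.
  have hc : ∀ i, c i ∈ regularAt (genericPoint S) := fun i => ⟨c i, by
    change S.presheaf.stalkSpecializes (specializes_refl _) (c i) = c i
    simp⟩
  choose O hO f hf using fun i => exists_section_of_mem_regularAt (hc i)
  refine ⟨W ⊓ (O 0 ⊓ O 1), inf_le_left, ⟨hη, hO 0, hO 1⟩,
    fun i => S.presheaf.map (homOfLE (?_ : _ ≤ O i)).op (f i), fun i y hy => ?_⟩
  · fin_cases i
    exacts [inf_le_right.trans inf_le_left, inf_le_right.trans inf_le_right]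
  · rw [functionValue_map]
    exact hf i y _

end functionValue

/-! ### Sections of the dual as functionals -/

section Glue

variable {S : Scheme.{0}} [S.Over (Spec (.of ℂ))]

/-- A section of a sheaf of forms, as a family of germs. -/
def toForm {N : ∀ x : S, Submodule (S.presheaf.stalk x) (FormStalk S x)} {U : S.Opens}
    (m : Γ(formSheaf N, U)) : formSections N U := m

variable [IsIntegral S]

/-- The value at `y` of a section of a sheaf of forms, as a rational form. -/
def formValue {N : ∀ x : S, Submodule (S.presheaf.stalk x) (FormStalk S x)} {U : S.Opens}
    (m : Γ(formSheaf N, U)) {y : S} (hy : y ∈ U) : Ω[S.functionField⁄ℂ] :=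
  toRational y ((toForm m).1 ⟨y, hy⟩)

section formValue

variable {N : ∀ x : S, Submodule (S.presheaf.stalk x) (FormStalk S x)} {U W : S.Opens}

theorem formValue_eq (m : Γ(formSheaf N, U)) {x y : S} (hx : x ∈ U) (hy : y ∈ U) :
    formValue m hx = formValue m hy :=
  toRational_form_eq (toForm m).2.1 ⟨x, hx⟩ ⟨y, hy⟩

theorem formValue_map (h : W ≤ U) (m : Γ(formSheaf N, U)) {y : S} (hy : y ∈ W) :
    formValue ((formSheaf N).presheaf.map (homOfLE h).op m) hy = formValue m (h hy) := rfl

theorem formValue_add (m m' : Γ(formSheaf N, U)) {y : S} (hy : y ∈ U) :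
    formValue (m + m') hy = formValue m hy + formValue m' hy :=
  map_add (toRational y) _ _

theorem formValue_smul (r : Γ(S, U)) (m : Γ(formSheaf N, U)) {y : S} (hy : y ∈ U) :
    formValue (r • m) hy = functionValue r hy • formValue m hy :=
  toRational_smul y _ _

theorem exists_formValue_eq (m : Γ(formSheaf N, U)) {y : S} (hy : y ∈ U) :
    ∃ n ∈ N y, toRational y n = formValue m hy :=
  ⟨_, (toForm m).2.2 ⟨y, hy⟩, rfl⟩

theorem exists_section_formValue [SmoothOfRelativeDimension 2 (S ↘ Spec (.of ℂ))]
    {ω : Ω[S.functionField⁄ℂ]} (hω : ∀ y ∈ U, ∃ n ∈ N y, toRational y n = ω) :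
    ∃ m : Γ(formSheaf N, U), ∀ (y : S) (hy : y ∈ U), formValue m hy = ω := by
  obtain ⟨s, hs⟩ := exists_formSection hω
  exact ⟨s, fun y hy => hs ⟨y, hy⟩⟩

theorem formValue_ext [SmoothOfRelativeDimension 2 (S ↘ Spec (.of ℂ))] {m m' : Γ(formSheaf N, U)}
    (h : ∀ (y : S) (hy : y ∈ U), formValue m hy = formValue m' hy) : m = m' :=
  formSections_ext (s := toForm m) (s' := toForm m') fun y => h y.1 y.2

end formValue

/-- The functional `l` on rational forms extends the section `ψ` of the dual of the image of the
evaluation map. -/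
def Represents {V : Submodule ℂ (GlobalForms S)} {W : S.Opens} (ψ : DualSection (formSheaf (evalStalk V)) W)
    (l : Ω[S.functionField⁄ℂ] →ₗ[S.functionField] S.functionField) : Prop :=
  ∀ (W' : S.Opens) (h : W' ≤ W) (m : Γ(formSheaf (evalStalk V), W')) (y : S) (hy : y ∈ W'),
    functionValue (ψ.app W' h m) hy = l (formValue m hy)

namespace Represents

variable {V : Submodule ℂ (GlobalForms S)} {W : S.Opens} {ψ ψ' : DualSection (formSheaf (evalStalk V)) W}
  {l l' : Ω[S.functionField⁄ℂ] →ₗ[S.functionField] S.functionField}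

theorem res {W' : S.Opens} (h : W' ≤ W) (hψ : Represents ψ l) :
    Represents (DualSection.res h ψ) l :=
  fun W'' h' m y hy => hψ W'' (h'.trans h) m y hy

theorem add (hψ : Represents ψ l) (hψ' : Represents ψ' l') : Represents (ψ + ψ') (l + l') := by
  intro W' h m y hy
  rw [DualSection.add_app, LinearMap.add_apply, functionValue_add,
    LinearMap.add_apply, hψ W' h m y hy, hψ' W' h m y hy]

theorem smul (hψ : Represents ψ l) (r : Γ(S, W)) {c : S.functionField}
    (hr : ∀ (y : S) (hy : y ∈ W), functionValue r hy = c) : Represents (r • ψ) (c • l) := by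
  intro W' h m y hy
  rw [DualSection.smul_app, LinearMap.smul_apply, LinearMap.smul_apply, smul_eq_mul, smul_eq_mul,
    functionValue_mul, functionValue_map, hψ W' h m y hy, hr y (h hy)]

theorem eq (hψ : Represents ψ l) (hψ' : Represents ψ' l) : ψ = ψ' := by
  refine DualSection.ext ?_
  funext W' h
  refine LinearMap.ext fun m => functionValue_ext fun y hy => ?_
  exact (hψ W' h m y hy).trans (hψ' W' h m y hy).symm

end Represents

variable {V : Submodule ℂ (GlobalForms S)}

/-- Every functional regular on `V` defines a section of the dual. -/
theorem exists_represents {W : S.Opens}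
    {l : Ω[S.functionField⁄ℂ] →ₗ[S.functionField] S.functionField}
    (hl : IsRegularFunctional V W l) : ∃ ψ : DualSection (formSheaf (evalStalk V)) W, Represents ψ l := by
  have hex : ∀ (W' : S.Opens) (_ : W' ≤ W) (m : Γ(formSheaf (evalStalk V), W')),
      ∃ f : Γ(S, W'), ∀ (y : S) (hy : y ∈ W'), functionValue f hy = l (formValue m hy) := by
    intro W' h m
    -- On the empty open there is no point at which to read the value; there the section is taken to
    -- be 0.
    by_cases hne : ∃ x, x ∈ W'
    · obtain ⟨x, hx⟩ := hne
      obtain ⟨f, hf⟩ := exists_functionValue_eq (U := W')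
        (g := l (formValue m hx)) (fun y hy => by
          rw [formValue_eq m hx hy]
          exact IsRegularFunctional.apply_mem (fun v hv => hl v hv y (h hy))
            ((toForm m).2.2 ⟨y, hy⟩))
      exact ⟨f, fun y hy => (hf y hy).trans (by rw [formValue_eq m hx hy])⟩
    · exact ⟨0, fun y hy => absurd ⟨y, hy⟩ hne⟩
  choose f hf using hex
  refine ⟨{ app := fun W' h =>
              { toFun := f W' h
                map_add' := fun m m' => functionValue_ext fun y hy => ?_
                map_smul' := fun r m => functionValue_ext fun y hy => ?_ }
            naturality := fun {W₁ W₂} h hW m => functionValue_ext fun y hy => ?_ },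
    fun W' h m y hy => hf W' h m y hy⟩
  · refine (hf W' h _ y hy).trans ?_
    rw [functionValue_add, hf W' h m y hy, hf W' h m' y hy, ← map_add]
    exact congr_arg l (formValue_add m m' hy)
  · refine (hf W' h _ y hy).trans ?_
    rw [RingHom.id_apply, smul_eq_mul, functionValue_mul, hf W' h m y hy, ← smul_eq_mul, ← map_smul]
    exact congr_arg l (formValue_smul r m hy)
  · refine (hf W₂ _ _ y hy).trans ?_
    refine Eq.trans ?_ ((functionValue_map h _ hy).trans (hf W₁ hW m y (h hy))).symm
    rfl

variable [SmoothOfRelativeDimension 2 (S ↘ Spec (.of ℂ))]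

/-- Generic surjectivity makes `V` span the rational forms, so a basis can be extracted from `V`;
comparison with a frame shows that it has two elements. -/
theorem exists_rational_basis (hV : evalStalk V (genericPoint S) = ⊤) :
    ∃ (v : Fin 2 → GlobalForms S) (B : Module.Basis (Fin 2) S.functionField Ω[S.functionField⁄ℂ]),
      (∀ i, v i ∈ V) ∧ ∀ i, B i = (v i).rational := by
  obtain ⟨W, hW, E, -⟩ := exists_rational_frame (genericPoint S)
  have hs := (span_rational_eq_top hV).ge
  let B₀ := Module.Basis.ofSpan hs
  let B := B₀.reindex (B₀.indexEquiv E)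
  have hB : ∀ i, ∃ v ∈ V, v.rational = B i := fun i => by
    refine Module.Basis.ofSpan_subset hs ?_
    rw [Module.Basis.reindex_apply]
    exact ⟨_, rfl⟩
  choose v hv hvB using hB
  exact ⟨v, B, hv, fun i => (hvB i).symm⟩

/-- The section of the image of the evaluation map defined by a form in `V`. -/
theorem exists_section_rational {v : GlobalForms S} (hv : v ∈ V) (W : S.Opens) :
    ∃ m : Γ(formSheaf (evalStalk V), W), ∀ (y : S) (hy : y ∈ W), formValue m hy = v.rational :=
  exists_section_formValue fun y _ =>
    ⟨v.germ y, Submodule.subset_span ⟨v, hv, rfl⟩, toRational_globalForm y v⟩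

/-- The converse of `exists_represents`: each `v` in `V` is itself a section of the evaluation
image, and `ψ` takes it to a regular function. -/
theorem Represents.isRegularFunctional {W : S.Opens} {ψ : DualSection (formSheaf (evalStalk V)) W}
    {l : Ω[S.functionField⁄ℂ] →ₗ[S.functionField] S.functionField} (h : Represents ψ l) :
    IsRegularFunctional V W l := by
  intro v hv y hy
  obtain ⟨m, hm⟩ := exists_section_rational hv W
  rw [← hm y hy, ← h W le_rfl m y hy]
  exact functionValue_mem_regularAt _ _

theorem Represents.functional_eq (hV : evalStalk V (genericPoint S) = ⊤) {W : S.Opens}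
    {ψ : DualSection (formSheaf (evalStalk V)) W}
    {l l' : Ω[S.functionField⁄ℂ] →ₗ[S.functionField] S.functionField} {x : S} (hx : x ∈ W)
    (h : Represents ψ l) (h' : Represents ψ l') : l = l' := by
  obtain ⟨v, B, hv, hB⟩ := exists_rational_basis hV
  refine B.ext fun i => ?_
  obtain ⟨m, hm⟩ := exists_section_rational (hv i) W
  rw [hB, ← hm x hx, ← h W le_rfl m x hx, ← h' W le_rfl m x hx]

end Glue

/-! ### The bidual as a sheaf of rational forms -/

section Reflexive

theorem functionValue_app {S : Scheme.{0}} [IsIntegral S] {M : S.Modules} {U W W' : S.Opens}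
    (ψ : DualSection M U) (h : W' ≤ W) (hW : W ≤ U) (hW' : W' ≤ U) (m : Γ(M, W))
    {y : S} (hy : y ∈ W') :
    functionValue (ψ.app W' hW' (M.presheaf.map (homOfLE h).op m)) hy =
      functionValue (ψ.app W hW m) (h hy) := by
  rw [ψ.naturality h hW, functionValue_map]

variable {S : Scheme.{0}} [S.Over (Spec (.of ℂ))] [IsIntegral S]
  {V : Submodule ℂ (GlobalForms S)} {F : EffectiveDivisor S} {U : S.Opens}

/-- The section `Φ` of the bidual is the evaluation of functionals at the section `n`. -/
def IsEvaluation (Φ : DualSection (dual (formSheaf (evalStalk V))) U)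
    (n : Γ(formSheaf (logTwistStalk F), U)) : Prop :=
  ∀ (W : S.Opens) (h : W ≤ U) (ψ : Γ(dual (formSheaf (evalStalk V)), W))
    (l : Ω[S.functionField⁄ℂ] →ₗ[S.functionField] S.functionField), Represents (toDual ψ) l →
    ∀ (y : S) (hy : y ∈ W), functionValue (Φ.app W h ψ) hy = l (formValue n (h hy))

variable {Φ Φ' : DualSection (dual (formSheaf (evalStalk V))) U}
  {n n' : Γ(formSheaf (logTwistStalk F), U)}

namespace IsEvaluation

theorem add (h : IsEvaluation Φ n) (h' : IsEvaluation Φ' n') :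
    IsEvaluation (Φ + Φ') (n + n') := by
  intro W hW ψ l hl y hy
  rw [DualSection.add_app, LinearMap.add_apply, functionValue_add, h W hW ψ l hl y hy,
    h' W hW ψ l hl y hy, ← map_add]
  exact congr_arg l (formValue_add n n' (hW hy)).symm

theorem smul (r : Γ(S, U)) (h : IsEvaluation Φ n) : IsEvaluation (r • Φ) (r • n) := by
  intro W hW ψ l hl y hy
  rw [DualSection.smul_app, LinearMap.smul_apply, smul_eq_mul, functionValue_mul,
    functionValue_map, h W hW ψ l hl y hy, ← smul_eq_mul, ← map_smul]
  exact congr_arg l (formValue_smul r n (hW hy)).symm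

theorem res {W : S.Opens} (hW : W ≤ U) (h : IsEvaluation Φ n) :
    IsEvaluation (DualSection.res hW Φ)
      ((formSheaf (logTwistStalk F)).presheaf.map (homOfLE hW).op n) :=
  fun W' hW' ψ l hl y hy => h W' (hW'.trans hW) ψ l hl y hy

end IsEvaluation

variable [SmoothOfRelativeDimension 2 (S ↘ Spec (.of ℂ))]

/-- Every section of the dual extends to a functional on the rational forms. -/
theorem exists_functional (hV : evalStalk V (genericPoint S) = ⊤) {W : S.Opens} {x : S}
    (hx : x ∈ W) (ψ : DualSection (formSheaf (evalStalk V)) W) : ∃ l, Represents ψ l := by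
  obtain ⟨v, B, hv, hB⟩ := exists_rational_basis hV
  choose s hs using fun i => exists_section_rational (hv i) W
  refine ⟨B.constr S.functionField fun i => functionValue (ψ.app W le_rfl (s i)) hx,
    fun W' h m y hy => ?_⟩
  -- Over a smaller neighbourhood of the generic point the coordinates of `m` in the basis from `V`
  -- are regular, so linearity of `ψ` applies there; restriction does not change values in the
  -- function field.
  obtain ⟨W'', h', hη, f, hf⟩ := exists_open_sections (fun i => B.repr (formValue m hy) i) hy
  have hm : (formSheaf (evalStalk V)).presheaf.map (homOfLE h').op m =
      ∑ i, f i • (formSheaf (evalStalk V)).presheaf.map (homOfLE (h'.trans h)).op (s i) := by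
    refine formValue_ext fun z hz => ?_
    rw [Fin.sum_univ_two]
    refine Eq.trans ?_ (formValue_add _ _ hz).symm
    rw [formValue_map, formValue_smul, formValue_smul, formValue_map, formValue_map, hs, hs,
      ← hB, ← hB, hf, hf, formValue_eq m _ hy,
      ← Fin.sum_univ_two fun i => B.repr (formValue m hy) i • B i, B.sum_repr]
  rw [functionValue_eq _ hy (h' hη), ← functionValue_app ψ h' h (h'.trans h) m hη, hm, map_sum,
    Fin.sum_univ_two, functionValue_add]
  simp only [map_smul, smul_eq_mul, functionValue_mul, hf]
  rw [functionValue_app ψ (h'.trans h) le_rfl, functionValue_app ψ (h'.trans h) le_rfl,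
    functionValue_eq (ψ.app W le_rfl (s 0)) _ hx, functionValue_eq (ψ.app W le_rfl (s 1)) _ hx,
    Module.Basis.constr_apply_fintype, Fin.sum_univ_two]
  rfl

theorem IsEvaluation.eq (hV : evalStalk V (genericPoint S) = ⊤) (h : IsEvaluation Φ n)
    (h' : IsEvaluation Φ' n) : Φ = Φ' := by
  refine DualSection.ext ?_
  funext W hW
  refine LinearMap.ext fun ψ => functionValue_ext fun y hy => ?_
  obtain ⟨l, hl⟩ := exists_functional hV hy (toDual ψ)
  rw [h W hW ψ l hl y hy, h' W hW ψ l hl y hy]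

/-- The coordinates of a frame are represented by sections of the dual, so `Φ` determines every
coordinate of `n`. -/
theorem IsEvaluation.section_eq (h : IsEvaluation Φ n) (h' : IsEvaluation Φ n') : n = n' := by
  refine formValue_ext fun y hy => ?_
  obtain ⟨W₀, hW₀, E, hE⟩ := exists_rational_frame y
  refine E.ext_elem fun i => ?_
  obtain ⟨ψ, hψ⟩ := exists_represents (W := U ⊓ W₀)
    (isRegularFunctional_coord (V := V) (W := U ⊓ W₀) (fun z hz => hE z hz.2) i)
  exact (h _ inf_le_left ψ _ hψ y ⟨hy, hW₀⟩).symm.trans (h' _ inf_le_left ψ _ hψ y ⟨hy, hW₀⟩)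

/-- The value at `ψ` is $l(n)$, a regular function by Hartogs; it depends only on `ψ`, since over a
nonempty open `ψ` determines `l`. -/
theorem exists_isEvaluation (hV : evalStalk V (genericPoint S) = ⊤)
    (hVF : GeneratesInCodimOne V F) (hS : HasRegularStalks S)
    (n : Γ(formSheaf (logTwistStalk F), U)) :
    ∃ Φ : DualSection (dual (formSheaf (evalStalk V))) U, IsEvaluation Φ n := by
  have hex : ∀ (W : S.Opens) (h : W ≤ U) (ψ : Γ(dual (formSheaf (evalStalk V)), W)),
      ∃ f : Γ(S, W), ∀ l, Represents (toDual ψ) l → ∀ (y : S) (hy : y ∈ W),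
        functionValue f hy = l (formValue n (h hy)) := by
    intro W h ψ
    by_cases hne : ∃ x, x ∈ W
    · obtain ⟨x, hx⟩ := hne
      obtain ⟨l, hl⟩ := exists_functional hV hx (toDual ψ)
      obtain ⟨f, hf⟩ := exists_functionValue_eq (U := W) (g := l (formValue n (h hx)))
        fun y hy => mem_regularAt_of_mem_logTwistStalk hVF hS hl.isRegularFunctional
          (fun z hz => by
            rw [formValue_eq n (h hx) (h hz)]
            exact exists_formValue_eq n (h hz)) hy
      refine ⟨f, fun l' hl' y hy => ?_⟩
      rw [hf, hl.functional_eq hV hx hl', formValue_eq n (h hx) (h hy)]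
    · exact ⟨0, fun l _ y hy => absurd ⟨y, hy⟩ hne⟩
  choose f hf using hex
  refine ⟨{ app := fun W h =>
              { toFun := f W h
                map_add' := fun ψ ψ' => functionValue_ext fun y hy => ?_
                map_smul' := fun r ψ => functionValue_ext fun y hy => ?_ }
            naturality := fun {W W'} h hW ψ => functionValue_ext fun y hy => ?_ },
    fun W h ψ l hl y hy => hf W h ψ l hl y hy⟩
  · obtain ⟨l, hl⟩ := exists_functional hV hy (toDual ψ)
    obtain ⟨l', hl'⟩ := exists_functional hV hy (toDual ψ')
    rw [functionValue_add, hf W h ψ l hl y hy, hf W h ψ' l' hl' y hy,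
      hf W h (ψ + ψ') _ (hl.add hl') y hy, LinearMap.add_apply]
  · obtain ⟨l, hl⟩ := exists_functional hV hy (toDual ψ)
    rw [RingHom.id_apply, smul_eq_mul, functionValue_mul, hf W h ψ l hl y hy,
      hf W h (r • ψ) _ (hl.smul r fun z hz => functionValue_eq r hz hy) y hy, LinearMap.smul_apply,
      smul_eq_mul]
  · obtain ⟨l, hl⟩ := exists_functional hV (h hy) (toDual ψ)
    rw [functionValue_map]
    exact (hf W' _ _ _ (hl.res h) y hy).trans (hf W hW ψ l hl y (h hy)).symm

/-- A section of the bidual is the evaluation at some rational form. -/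
theorem exists_rational_of_dualSection {x : S} (hx : x ∈ U)
    (Φ : DualSection (dual (formSheaf (evalStalk V))) U) :
    ∃ ω : Ω[S.functionField⁄ℂ], ∀ (W : S.Opens) (h : W ≤ U)
      (ψ : Γ(dual (formSheaf (evalStalk V)), W)) (l : _ →ₗ[S.functionField] S.functionField),
      Represents (toDual ψ) l → ∀ (y : S) (hy : y ∈ W), functionValue (Φ.app W h ψ) hy = l ω := by
  obtain ⟨W₀, hW₀, E, hE⟩ := exists_rational_frame x
  have hex : ∀ i, ∃ ψ : Γ(dual (formSheaf (evalStalk V)), U ⊓ W₀),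
      Represents (toDual ψ) (E.coord i) := fun i =>
    exists_represents (isRegularFunctional_coord (W := U ⊓ W₀) (fun z hz => hE z hz.2) i)
  choose ψ hψ using hex
  -- The coordinates of $\omega$ are the values of `Φ` on the dual frame. Near the generic point any
  -- `φ` represented by `l` is $\sum l(E_i)\psi_i$, which forces $\Phi(\varphi)=l(\omega)$.
  refine ⟨∑ i, functionValue (Φ.app _ inf_le_left (ψ i)) ⟨hx, hW₀⟩ • E i,
    fun W h φ l hl y hy => ?_⟩
  have hη := genericPoint_mem hy
  obtain ⟨W', h', hη', f, hf⟩ := exists_open_sections (W := W ⊓ (U ⊓ W₀)) (fun i => l (E i))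
    ⟨hη, h hη, genericPoint_mem hW₀⟩
  have hφ : (dual (formSheaf (evalStalk V))).presheaf.map
      (homOfLE (h'.trans inf_le_left)).op φ =
      f 0 • (dual (formSheaf (evalStalk V))).presheaf.map
        (homOfLE (h'.trans inf_le_right)).op (ψ 0) +
      f 1 • (dual (formSheaf (evalStalk V))).presheaf.map
        (homOfLE (h'.trans inf_le_right)).op (ψ 1) := by
    refine Represents.eq (l := l) (hl.res (h'.trans inf_le_left)) ?_
    have hsum : l = l (E 0) • E.coord 0 + l (E 1) • E.coord 1 := by
      refine E.ext fun i => ?_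
      fin_cases i <;> simp
    rw [hsum]
    exact (((hψ 0).res (h'.trans inf_le_right)).smul (f 0) (hf 0)).add
      (((hψ 1).res (h'.trans inf_le_right)).smul (f 1) (hf 1))
  rw [functionValue_eq _ hy ((h'.trans inf_le_left) hη'),
    ← functionValue_app Φ (h'.trans inf_le_left) h ((h'.trans inf_le_left).trans h) φ hη', hφ,
    map_add, functionValue_add, map_smul, map_smul, smul_eq_mul, smul_eq_mul, functionValue_mul,
    functionValue_mul, hf, hf, functionValue_app Φ (h'.trans inf_le_right) inf_le_left,
    functionValue_app Φ (h'.trans inf_le_right) inf_le_left,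
    functionValue_eq (Φ.app _ inf_le_left (ψ 0)) _ ⟨hx, hW₀⟩,
    functionValue_eq (Φ.app _ inf_le_left (ψ 1)) _ ⟨hx, hW₀⟩, Fin.sum_univ_two, map_add, map_smul,
    map_smul, smul_eq_mul, smul_eq_mul, mul_comm, mul_comm (l (E 1))]

/-- Every functional `l` regular on `V` comes from a section `ψ` of the dual, so
$l(\omega)=\Phi(\psi)$ is regular for all of them, and `exists_mem_logTwistStalk_of_forall` puts
$\omega$ in the logarithmic sheaf. -/
theorem exists_section_isEvaluation (hVF : GeneratesInCodimOne V F)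
    (hred : F.IsReduced) (hnc : F.HasSimpleNormalCrossings)
    (Φ : DualSection (dual (formSheaf (evalStalk V))) U) :
    ∃ n : Γ(formSheaf (logTwistStalk F), U), IsEvaluation Φ n := by
  by_cases hne : ∃ x, x ∈ U
  · obtain ⟨x, hx⟩ := hne
    obtain ⟨ω, hω⟩ := exists_rational_of_dualSection hx Φ
    obtain ⟨n, hn⟩ := exists_section_formValue (U := U) (ω := ω) fun y hy =>
      exists_mem_logTwistStalk_of_forall hVF hred hnc (fun W hW l hl z hz => by
        obtain ⟨ψ, hψ⟩ := exists_represents hl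
        rw [← hω W hW ψ l hψ z hz]
        exact functionValue_mem_regularAt _ _) hy
    refine ⟨n, fun W hW ψ l hl y hy => ?_⟩
    rw [hn, hω W hW ψ l hl y hy]
  · exact ⟨0, fun W hW ψ l hl y hy => absurd ⟨y, hW hy⟩ hne⟩

/-- The sheaf of forms generated by `V` in codimension one is the bidual of the image of the
evaluation map. -/
theorem nonempty_bidual_iso (hV : evalStalk V (genericPoint S) = ⊤)
    (hVF : GeneratesInCodimOne V F) (hred : F.IsReduced) (hnc : F.HasSimpleNormalCrossings) :
    Nonempty (dual (dual (formSheaf (evalStalk V))) ≅ formSheaf (logTwistStalk F)) := by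
  have hS := hasRegularStalks_of_normalCrossings hnc
  choose Φ hΦ using fun (U : S.Opens) (n : Γ(formSheaf (logTwistStalk F), U)) =>
    exists_isEvaluation hV hVF hS n
  -- The isomorphism is built from the logarithmic sheaf to the bidual. Uniqueness of the evaluation
  -- at a form yields linearity and compatibility with restriction.
  let f (U : S.Opens) : Γ(formSheaf (logTwistStalk F), U) →ₗ[Γ(S, U)]
      Γ(dual (dual (formSheaf (evalStalk V))), U) :=
    { toFun := Φ U
      map_add' := fun n n' => (hΦ U _).eq hV ((hΦ U n).add (hΦ U n'))
      map_smul' := fun r n => (hΦ U _).eq hV ((hΦ U n).smul r) }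
  have := isIso_homOfSections f (fun U W h n => (hΦ W _).eq hV ((hΦ U n).res h)) fun U =>
    ⟨fun n n' (h : Φ U n = Φ U n') => (hΦ U n).section_eq (h ▸ hΦ U n'), fun Ψ => by
      obtain ⟨n, hn⟩ := exists_section_isEvaluation hVF hred hnc Ψ
      exact ⟨n, (hΦ U n).eq hV hn⟩⟩
  exact ⟨(asIso (homOfSections f _)).symm⟩

end Reflexive

end ContractedDivisor

end

theorem mainTheorem8 (S : Scheme.{0}) [S.Over (Spec (.of ℂ))] [IsIntegral S]
    [SmoothOfRelativeDimension 2 (S ↘ Spec (.of ℂ))] [IsProper (S ↘ Spec (.of ℂ))]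
    (V : Submodule ℂ (GlobalForms S))
    (hV : evalStalk V (genericPoint S) = ⊤)
    (F : EffectiveDivisor S) (hF : IsBaseDivisor V F)
    (hred : F.IsReduced) (hnc : F.HasSimpleNormalCrossings)
    (hcontr : IsContractedBy F V) :
    Nonempty (dual (dual (omegaBar V)) ≅ omegaLogTwist F) := by
  -- The base divisor and contraction hypotheses enter only through generation in codimension one;
  -- `omegaBar V` and `omegaLogTwist F` are by definition the two sheaves of forms compared here.
  exact nonempty_bidual_iso hV
    (fun C e => exists_generators_logTwistStalk hF hred hnc hcontr C e) hred hnc
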